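/- **Theorem (privacy of the private text generation algorithm).** Let $\mathcal X$ be a finite token vocabulary with a distinguished token $\langle\mathrm{eos}\rangle$. Prompts are elements of $\mathcal X^*$, and datasets are finite sets of prompts. Two datasets are *neighbors* if $D=D'\cup\{p\}$ or $D'=D\cup\{p\}$ for some prompt $p$. Parameters: a function $\mathrm{logits}:\mathcal X^*\to\mathbb R^{\mathcal X}$, a public prompt $p_{\mathrm{pub}}$, reals $s,\tau,\tau_{\mathrm{pub}},\sigma>0$, $c\ge 0$, $\theta\in\mathbb R$, and an integer $r\ge 0$. Write $\mathrm{softmax}(z)_i=e^{z_i}/\sum_j e^{z_j}$, $\mathrm{clip}_c(z)_i=\max\{-c,\,z_i-\max_j z_j+c\}$ and, for a finite set $Z$ of logit vectors, $d(Z,z)=\big\|\frac1s\sum_{z'\in Z}\mathrm{softmax}(z')-\mathrm{softmax}(z)\big\|_1$. $\mathrm{Laplace}(b)$ is the centered Laplace distribution of scale $b$; all draws below are fresh and independent. *Algorithm.* Let $f$ be a function from prompts to $\{1,\dots,k\}$ (so the batch of a prompt depends only on the prompt itself). On input $D$, start with $X=\emptyset$, and for each $i\in\{1,\dots,k\}$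 process the batch $S=\{p\in D: f(p)=i\}$ (which may be empty) as follows. Set $\hat\theta\leftarrow\theta+\mathrm{Laplace}(\sigma)$ and $t\leftarrow0$. While $t<r$: let $x$ be the empty sequence; while $x$ does not end with $\langle\mathrm{eos}\rangle$ and $t<r$, let $Z=\{\mathrm{logits}(px):p\in S\}$, $z_{\mathrm{pub}}=\mathrm{logits}(p_{\mathrm{pub}}x)$ and $\hat d\leftarrow d(Z,z_{\mathrm{pub}})+\mathrm{Laplace}(2\sigma)$; if $\hat d\ge\hat\theta$, draw a token $a\sim\mathrm{softmax}\big(\frac1{s\tau}\sum_{z\in Z}\mathrm{clip}_c(z)\big)$, set $t\leftarrow t+1$ and $\hat\theta\leftarrow\theta+\mathrm{Laplace}(\sigma)$; otherwise draw $a\sim\mathrm{softmax}(z_{\mathrm{pub}}/\tau_{\mathrm{pub}})$; append $a$ to $x$. When the inner loop ends, set $X\leftarrow X\cup\{x\}$. Return $X$. Let $$\rho=r\left(\frac12\Big(\frac{c}{s\tau}\Big)^2+\frac{2}{(s\sigma)^2}\right).$$ Then the algorithm terminates almost surely on every dataset, and, writing $M(D)$ for the law of its output: 1. it is $\rho$-zCDP: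 $D_\alpha(M(D)\,\|\,M(D'))\le\rho\alpha$ for all $\alpha>1$ and all neighbors $D,D'$, where $D_\alpha$ is the Rényi divergence of order $\alpha$; 2. for every $\varepsilon\ge0$ it is $(\varepsilon,\delta)$-differentially private, i.e. $M(D)(O)\le e^{\varepsilon}M(D')(O)+\delta$ for all neighbors $D,D'$ and all sets $O$ of outputs, with $$\delta=\inf_{\alpha\in(1,\infty)}\frac{e^{(\alpha-1)(\alpha\rho-\varepsilon)}}{\alpha-1}\Big(1-\frac1\alpha\Big)^{\alpha};$$ 3. for every $\delta\in(0,1]$ it is $(\varepsilon,\delta)$-differentially private with $\varepsilon=\rho+\sqrt{4\rho\log(1/\delta)}$. -/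

import Mathlib

open MeasureTheory ProbabilityTheory

namespace PrivatePrediction

/-! ### Differential privacy -/

section Privacy

variable {P Ω : Type*}

/-- Add/remove neighbors: `D = D' ∪ {p}` or `D' = D ∪ {p}` for some `p`. -/
def Neighbors [DecidableEq P] (D D' : Finset P) : Prop :=
  ∃ p : P, D = D' ∪ {p} ∨ D' = D ∪ {p}

/-- The Rényi divergence of order `α` (used for `α > 1`, between probability measures):
`1 / (α - 1) * log ∫ (dμ/dν) ^ α dν` if `μ ≪ ν`, and `∞` otherwise. -/
noncomputable def renyiDiv [MeasurableSpace Ω] (α : ℝ) (μ ν : Measure Ω) : EReal :=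
  open scoped Classical in
  if μ ≪ ν then
    (((α - 1)⁻¹ : ℝ) : EReal) * ENNReal.log (∫⁻ x, (μ.rnDeriv ν x) ^ α ∂ν)
  else ⊤

/-- `ρ`-zero-concentrated differential privacy of a mechanism, given by its output laws. -/
def IsZCDP [DecidableEq P] [MeasurableSpace Ω] (M : Finset P → Measure Ω) (ρ : ℝ) : Prop :=
  ∀ α : ℝ, 1 < α → ∀ D D' : Finset P, Neighbors D D' →
    renyiDiv α (M D) (M D') ≤ ((ρ * α : ℝ) : EReal)

/-- `(ε, δ)`-differential privacy of a mechanism, given by its output laws. -/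
def IsDP [DecidableEq P] [MeasurableSpace Ω] (M : Finset P → Measure Ω) (ε δ : ℝ) : Prop :=
  ∀ D D' : Finset P, Neighbors D D' → ∀ O : Set Ω,
    M D O ≤ ENNReal.ofReal (Real.exp ε) * M D' O + ENNReal.ofReal δ

end Privacy

/-! ### Noise, softmax, clipping, distance -/

/-- The centered Laplace distribution with scale `b > 0`: density `exp (-|x| / b) / (2 * b)`. -/
noncomputable def laplace (b : ℝ) : Measure ℝ :=
  volume.withDensity fun x => ENNReal.ofReal (Real.exp (-|x| / b) / (2 * b))

section Logits

variable {V : Type*} [Fintype V]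

/-- Softmax of a logit vector: the probability vector proportional to `exp (z i)`. -/
noncomputable def softmax (z : V → ℝ) (i : V) : ℝ :=
  Real.exp (z i) / ∑ j, Real.exp (z j)

/-- Clipping with recentering: `max {-c, z i - max_j z j + c}`. -/
noncomputable def clip (c : ℝ) (z : V → ℝ) (i : V) : ℝ :=
  max (-c) (z i - (⨆ j, z j) + c)

/-- The aggregated logit vector `(1 / s) ∑_{z ∈ Z} clip_c z`. -/
noncomputable def aggregate (c s : ℝ) (Z : Finset (V → ℝ)) (i : V) : ℝ :=
  1 / s * ∑ z ∈ Z, clip c z i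

/-- The distance `‖(1 / s) ∑_{z ∈ Z} softmax z - softmax zpub‖₁`. -/
noncomputable def dist₁ (s : ℝ) (Z : Finset (V → ℝ)) (zpub : V → ℝ) : ℝ :=
  ∑ i, |1 / s * ∑ z ∈ Z, softmax z i - softmax zpub i|

end Logits

/-! ### The algorithm -/

/-- The parameters of the algorithm over the token vocabulary `V`. -/
structure Params (V : Type*) where
  /-- the language model -/
  logits : List V → V → ℝ
  /-- the end-of-sequence token -/
  eos : V
  /-- the public prompt -/
  pubPrompt : List V
  /-- expected batch size -/
  s : ℝ
  /-- number of private tokens to sample -/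
  r : ℕ
  /-- clipping bound -/
  c : ℝ
  /-- temperature -/
  τ : ℝ
  /-- public temperature -/
  τpub : ℝ
  /-- threshold -/
  θ : ℝ
  /-- noise level -/
  σ : ℝ

/-- The discrete program variables: the private token counter `t`, the token sequence `x` that is
being generated, and the set `X` of examples that were generated so far. -/
structure Config (V : Type*) where
  t : ℕ
  x : List V
  X : Finset (List V)

instance (V : Type*) : MeasurableSpace (Config V) := ⊤

instance (V : Type*) : DiscreteMeasurableSpace (Config V) := ⟨fun _ => trivial⟩

instance (V : Type*) [Countable V] : Countable (Config V) := by
  have h : Function.Injective fun q : Config V => (q.t, q.x, q.X) := by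
    rintro ⟨t, x, X⟩ ⟨t', x', X'⟩ h
    simpa using h
  exact h.countable

/-- The full program state while a batch is processed: the noisy threshold and the discrete
program variables. -/
abbrev State (V : Type*) := ℝ × Config V

section Algorithm

variable {V : Type*} [Fintype V] [DecidableEq V]

/-- The set `{logits (p x) : p ∈ S}` of logit vectors of the batch `S`. -/
noncomputable def batchLogits (A : Params V) (S : Finset (List V)) (x : List V) :
    Finset (V → ℝ) :=
  open scoped Classical in S.image fun p => A.logits (p ++ x)

/-- The public logit vector. -/
def pubLogits (A : Params V) (x : List V) : V → ℝ := A.logits (A.pubPrompt ++ x)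

/-- Append the token `a` to `x` and set the private token counter to `t'`. If generation of the
current example stops there (`a` is the end-of-sequence token, or the budget of `r` private tokens
is used up), add the example to `X` and start over from the empty sequence. -/
def Config.append (A : Params V) (q : Config V) (a : V) (t' : ℕ) : Config V :=
  if a = A.eos ∨ A.r ≤ t' then ⟨t', [], q.X ∪ {q.x ++ [a]}⟩ else ⟨t', q.x ++ [a], q.X⟩

/-- Private branch: draw `a ~ softmax (z̄ / τ)`, increment the counter, redraw the threshold. -/
noncomputable def privateLaw (A : Params V) (S : Finset (List V)) (q : Config V) :
    Measure (State V) :=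
  ∑ a : V, ENNReal.ofReal (softmax (fun i => aggregate A.c A.s (batchLogits A S q.x) i / A.τ) a) •
    (laplace A.σ).map fun η => (A.θ + η, q.append A a (q.t + 1))

/-- Public branch: draw `a ~ softmax (zpub / τpub)`, keep the counter and the threshold. -/
noncomputable def publicLaw (A : Params V) (q : Config V) (θ' : ℝ) : Measure (State V) :=
  ∑ a : V, ENNReal.ofReal (softmax (fun i => pubLogits A q.x i / A.τpub) a) •
    Measure.dirac (θ', q.append A a q.t)

/-- The law of the state after one iteration of the token loop. Once `r` private tokens have been
drawn the program has halted and the state does not change any more. -/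
noncomputable def stepLaw (A : Params V) (S : Finset (List V)) (st : State V) :
    Measure (State V) :=
  if A.r ≤ st.2.t then Measure.dirac st
  else (laplace (2 * A.σ)).bind fun ξ =>
    if st.1 ≤ dist₁ A.s (batchLogits A S st.2.x) (pubLogits A st.2.x) + ξ
    then privateLaw A S st.2 else publicLaw A st.2 st.1


theorem measurable_publicLaw (A : Params V) (q : Config V) : Measurable (publicLaw A q) := by
  refine Measure.measurable_of_measurable_coe _ fun s hs => ?_
  simp only [publicLaw, Measure.coe_finsetSum, Finset.sum_apply, Measure.smul_apply,
    smul_eq_mul]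
  refine Finset.measurable_sum _ fun a _ => Measurable.const_mul ?_ _
  exact (Measure.measurable_coe hs).comp
    (Measure.measurable_dirac.comp (measurable_id.prodMk measurable_const))

theorem measurable_stepLaw (A : Params V) (S : Finset (List V)) : Measurable (stepLaw A S) := by
  refine measurable_from_prod_countable_left fun q => ?_
  by_cases hr : A.r ≤ q.t
  · simp only [stepLaw, hr, if_true]
    exact Measure.measurable_dirac.comp (measurable_id.prodMk measurable_const)
  · simp only [stepLaw, hr, if_false]
    have hm : Measurable fun p : ℝ × ℝ =>
        if p.1 ≤ dist₁ A.s (batchLogits A S q.x) (pubLogits A q.x) + p.2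
        then privateLaw A S q else publicLaw A q p.1 :=
      Measurable.ite (measurableSet_le measurable_fst (measurable_const.add measurable_snd))
        measurable_const ((measurable_publicLaw A q).comp measurable_fst)
    have : SFinite (laplace (2 * A.σ)) := by unfold laplace; infer_instance
    refine Measure.measurable_of_measurable_coe _ fun s hs => ?_
    have h : ∀ y : ℝ, Measurable fun ξ : ℝ =>
        if y ≤ dist₁ A.s (batchLogits A S q.x) (pubLogits A q.x) + ξ
        then privateLaw A S q else publicLaw A q y := fun y =>
      hm.comp (measurable_const.prodMk measurable_id)
    have e : ∀ y : ℝ, _ := fun y =>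
      Measure.bind_apply (m := laplace (2 * A.σ)) hs (h y).aemeasurable
    simp only [e]
    exact ((Measure.measurable_coe hs).comp hm).lintegral_prod_right'

/-- One iteration of the token loop, as a transition kernel. -/
noncomputable def step (A : Params V) (S : Finset (List V)) : Kernel (State V) (State V) :=
  ⟨stepLaw A S, measurable_stepLaw A S⟩

/-- `n` iterations of the token loop. -/
noncomputable def steps (A : Params V) (S : Finset (List V)) : ℕ → Kernel (State V) (State V)
  | 0 => Kernel.id
  | n + 1 => step A S ∘ₖ steps A S n

/-- The law of the initial state: noisy threshold `θ + Laplace(σ)`, `t = 0`, nothing generated. -/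
noncomputable def initLaw (A : Params V) : Measure (State V) :=
  (laplace A.σ).map fun η => (A.θ + η, ⟨0, [], ∅⟩)

/-- The probability that the program on batch `S` has halted within `n` iterations of the token
loop with the set `X` of examples. -/
noncomputable def haltProb (A : Params V) (S : Finset (List V)) (n : ℕ) (X : Finset (List V)) :
    ENNReal :=
  (initLaw A).bind (steps A S n) {st | A.r ≤ st.2.t ∧ st.2.X = X}

/-- The law of the examples generated from one batch: `X` has the mass
`lim_n haltProb A S n X` (the sequence is nondecreasing in `n`). -/
noncomputable def batchLaw (A : Params V) (S : Finset (List V)) : Measure (Finset (List V)) :=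
  Measure.sum fun X : Finset (List V) => (⨆ n, haltProb A S n X) • Measure.dirac X

/-- The whole algorithm with `k` batches and batch assignment function `f`: the `i`-th batch is
`{p ∈ D : f p = i}`, batches are processed with independent randomness, and the output is the
union of the sets of examples generated from them. -/
noncomputable def algorithm (A : Params V) {k : ℕ} (f : List V → Fin k) (D : Finset (List V)) :
    Measure (Finset (List V)) :=
  (Measure.pi fun i : Fin k => batchLaw A (D.filter fun p => f p = i)).map
    fun Xs => Finset.univ.biUnion Xs

end Algorithm

end PrivatePrediction

open PrivatePrediction

/-! Privacy is carried in dual form: `HolderBound p B μ ν`, with `p` conjugate to `α`, bounds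
integrals against `μ` by `L^p` norms under `ν`. Such bounds pass through push-forwards and through
randomness common to both sides, and they compose along adaptive rounds without computing densities
of outputs.

A run on one batch splits into rounds. A round draws a fresh threshold, emits public tokens while
the noisy distance stays below it, and ends by drawing one private token. The program halts exactly
when the `r`-th private token is drawn, so no round is left unfinished. Two mechanisms are compared
on close batches:

The stopping part is the sparse vector technique (`roundLaw_le_smul`). Moving the threshold by `1 /
s` makes every public outcome at least as likely, so the long run of public tokens is free; only the
threshold shift and the single private outcome cost, in total a density ratio within `exp (± 2 / (s
σ))`.

The private token is an exponential mechanism (`exists_softmax_bounds`): log-probabilities move by a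
common constant up to `c / (s τ)`.

In both cases the log-density ratio lies in an interval of length `ℓ`, and Hoeffding's lemma gives
Rényi divergence at most `α ℓ² / 8` (`holderBound_of_smul_le`). The lengths `4 / (s σ)` and `2 c /
(s τ)` produce the two summands of `ρ`. Backward induction over the remaining private tokens
(`freshValue_le`) multiplies the cost by `r`.

A prompt affects only its own batch and batches are independent, so the bound for one batch is the
bound for the algorithm. The approximate guarantees follow by linearizing the Hölder bound on events
and choosing `α`. -/

namespace PrivatePrediction

open scoped ENNReal

/-! ### Rényi divergence bounds in dual form, and their consequences for events. -/

section HolderBound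

variable {Ω Ω' : Type*} [MeasurableSpace Ω] [MeasurableSpace Ω']

/-- The dual form of a bound on the Rényi divergence of `μ` from `ν`: integrals against `μ` are
bounded by `B` times the `L^p` norm with respect to `ν`. If `p` is conjugate to `α`, this says that
the `L^α` norm of the density is at most `B`. -/
def HolderBound (p : ℝ) (B : ℝ≥0∞) (μ ν : Measure Ω) : Prop :=
  ∀ g : Ω → ℝ≥0∞, Measurable g → ∫⁻ x, g x ∂μ ≤ B * (∫⁻ x, g x ^ p ∂ν) ^ (1 / p)

theorem HolderBound.refl {p : ℝ} (hp : 1 < p) (μ : Measure Ω) [IsProbabilityMeasure μ] :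
    HolderBound p 1 μ μ := by
  intro g hg
  have h := ENNReal.lintegral_mul_le_Lp_mul_Lq μ (Real.HolderConjugate.conjExponent hp)
    hg.aemeasurable (measurable_const (a := (1 : ℝ≥0∞))).aemeasurable
  simpa using h

theorem HolderBound.map {p : ℝ} {B : ℝ≥0∞} {μ ν : Measure Ω} (h : HolderBound p B μ ν)
    {φ : Ω → Ω'} (hφ : Measurable φ) : HolderBound p B (μ.map φ) (ν.map φ) := by
  intro g hg
  rw [lintegral_map hg hφ, lintegral_map (hg.pow_const p) hφ]
  exact h _ (hg.comp hφ)

/-- The bound is applied on each fibre; Jensen's inequality for `κ` then pulls the power `1 / p` out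
of the outer integral. -/
theorem HolderBound.prod_right {p : ℝ} (hp : 1 < p) {B : ℝ≥0∞} {μ ν : Measure Ω} [SFinite μ]
    [SFinite ν] (h : HolderBound p B μ ν) (κ : Measure Ω') [IsProbabilityMeasure κ] :
    HolderBound p B (μ.prod κ) (ν.prod κ) := by
  intro g hg
  rw [lintegral_prod_symm _ hg.aemeasurable, lintegral_prod_symm _ (hg.pow_const p).aemeasurable]
  have hm : Measurable fun y => ∫⁻ x, g (x, y) ^ p ∂ν := (hg.pow_const p).lintegral_prod_left'
  calc ∫⁻ y, ∫⁻ x, g (x, y) ∂μ ∂κ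
      ≤ ∫⁻ y, B * (∫⁻ x, g (x, y) ^ p ∂ν) ^ (1 / p) ∂κ :=
        lintegral_mono fun y => h _ (hg.comp measurable_prodMk_right)
    _ = B * ∫⁻ y, (∫⁻ x, g (x, y) ^ p ∂ν) ^ (1 / p) ∂κ :=
        lintegral_const_mul _ (hm.pow_const _)
    _ ≤ B * (∫⁻ y, ∫⁻ x, g (x, y) ^ p ∂ν ∂κ) ^ (1 / p) := by
        gcongr
        have := HolderBound.refl hp κ _ (hm.pow_const (1 / p))
        simp only [one_mul] at this
        refine this.trans_eq ?_
        simp only [← ENNReal.rpow_mul, one_div_mul_cancel (zero_lt_one.trans hp).ne',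
          ENNReal.rpow_one]

theorem HolderBound.pi_of_eq_of_ne {p : ℝ} (hp : 1 < p) {B : ℝ≥0∞} {k : ℕ}
    {μ ν : Fin k → Measure Ω} [∀ i, IsProbabilityMeasure (μ i)] [∀ i, IsProbabilityMeasure (ν i)]
    (i : Fin k) (h : HolderBound p B (μ i) (ν i)) (hne : ∀ j ≠ i, μ j = ν j) :
    HolderBound p B (Measure.pi μ) (Measure.pi ν) := by
  obtain _ | n := k
  · exact i.elim0
  have e : (fun j => μ (i.succAbove j)) = fun j => ν (i.succAbove j) :=
    funext fun j => hne _ (i.succAbove_ne j)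
  have hμ := ((measurePreserving_piFinSuccAbove μ i).symm).map_eq
  have hν := ((measurePreserving_piFinSuccAbove ν i).symm).map_eq
  rw [← hμ, ← hν, e]
  exact (h.prod_right hp _).map (MeasurableEquiv.measurable _)

/-- If the logarithm of the density of `μ` with respect to `ν` has values in `[a, b]`, then the
Rényi divergence of order `α` is at most `α (b - a) ^ 2 / 8`. -/
theorem holderBound_of_smul_le {α p : ℝ} (hα : α.HolderConjugate p) {μ ν : Measure Ω}
    [IsProbabilityMeasure μ] [IsProbabilityMeasure ν] {a b : ℝ}
    (ha : ENNReal.ofReal (Real.exp a) • ν ≤ μ) (hb : μ ≤ ENNReal.ofReal (Real.exp b) • ν) :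
    HolderBound p (ENNReal.ofReal (Real.exp ((α - 1) * ((b - a) ^ 2 / 8)))) μ ν := by
  have hac : μ ≪ ν := Measure.absolutelyContinuous_of_le_smul hb
  set D := μ.rnDeriv ν with hD
  have hDm : Measurable D := Measure.measurable_rnDeriv μ ν
  have hDb : D ≤ᵐ[ν] fun _ => ENNReal.ofReal (Real.exp b) := by
    refine ae_le_of_forall_setLIntegral_le_of_sigmaFinite hDm fun s hs _ => ?_
    rw [Measure.setLIntegral_rnDeriv hac, setLIntegral_const]
    exact hb s
  have hDa : (fun _ => ENNReal.ofReal (Real.exp a)) ≤ᵐ[ν] D := by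
    refine ae_le_of_forall_setLIntegral_le_of_sigmaFinite measurable_const fun s hs _ => ?_
    rw [Measure.setLIntegral_rnDeriv hac, setLIntegral_const]
    exact ha s
  set L : Ω → ℝ := fun x => Real.log (D x).toReal with hL
  have hLm : Measurable L := hDm.ennreal_toReal.log
  have hν : ∀ᵐ x ∂ν, D x = ENNReal.ofReal (Real.exp (L x)) ∧ L x ∈ Set.Icc a b := by
    filter_upwards [hDa, hDb] with x hxa hxb
    have ht : D x ≠ ⊤ := ne_top_of_le_ne_top ENNReal.ofReal_ne_top hxb
    have h1 : Real.exp a ≤ (D x).toReal := (ENNReal.ofReal_le_iff_le_toReal ht).1 hxa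
    have h2 : (D x).toReal ≤ Real.exp b := ENNReal.toReal_le_of_le_ofReal (Real.exp_pos _).le hxb
    have h0 : 0 < (D x).toReal := (Real.exp_pos a).trans_le h1
    refine ⟨?_, ?_, ?_⟩
    · rw [hL, Real.exp_log h0, ENNReal.ofReal_toReal ht]
    · exact (Real.le_log_iff_exp_le h0).2 h1
    · exact (Real.log_le_iff_le_exp h0).2 h2
  have hμ : ∀ᵐ x ∂μ, D x = ENNReal.ofReal (Real.exp (L x)) ∧ L x ∈ Set.Icc a b := hac.ae_le hν
  -- Hoeffding's lemma: under `μ`, `L` minus its mean is sub-Gaussian with variance proxy `((b - a)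
  -- / 2) ^ 2`. This is the source of the `8`.
  have hsub := hasSubgaussianMGF_of_mem_Icc hLm.aemeasurable (hμ.mono fun x h => h.2)
  set m := ∫ x, L x ∂μ with hm
  have hmgf : ∀ t, ∫ x, Real.exp (t * L x) ∂μ
      ≤ Real.exp (t * m + (b - a) ^ 2 / 8 * t ^ 2) := by
    intro t
    have h := hsub.mgf_le t
    have e : mgf (fun x => L x - m) μ t = Real.exp (-(t * m)) * ∫ x, Real.exp (t * L x) ∂μ := by
      rw [mgf, ← integral_const_mul]
      congr 1 with x
      rw [← Real.exp_add]; ring_nf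
    rw [e] at h
    have h' := mul_le_mul_of_nonneg_left h (Real.exp_pos (t * m)).le
    rw [← mul_assoc, ← Real.exp_add, add_neg_cancel, Real.exp_zero, one_mul, ← Real.exp_add] at h'
    refine h'.trans_eq ?_
    congr 1
    simp
    rw [div_pow, sq_abs]
    ring
  have hint : ∀ t, Integrable (fun x => Real.exp (t * L x)) μ := fun t =>
    integrable_exp_mul_of_mem_Icc hLm.aemeasurable (hμ.mono fun x h => h.2)
  have hpow : ∀ t : ℝ, ∫⁻ x, D x * D x ^ t ∂ν
      = ENNReal.ofReal (∫ x, Real.exp (t * L x) ∂μ) := by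
    intro t
    rw [lintegral_rnDeriv_mul hac (hDm.pow_const t).aemeasurable,
      ofReal_integral_eq_lintegral_ofReal (hint t) (ae_of_all _ fun x => (Real.exp_pos _).le)]
    refine lintegral_congr_ae ?_
    filter_upwards [hμ] with x hx
    rw [hx.1, ENNReal.ofReal_rpow_of_pos (Real.exp_pos _), ← Real.exp_mul, mul_comm]
  -- The mean `m` is the Kullback–Leibler divergence. At `t = -1` the moment generating function of
  -- `L` is the total mass of `ν`, so `1 ≤ exp (-m + (b - a) ^ 2 / 8)`.
  have hm8 : m ≤ (b - a) ^ 2 / 8 := by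
    have h1 : ∫⁻ x, D x * D x ^ (-1 : ℝ) ∂ν = 1 := by
      rw [← measure_univ (μ := ν), ← lintegral_one]
      refine lintegral_congr_ae ?_
      filter_upwards [hν] with x hx
      rw [hx.1, ENNReal.rpow_neg_one, ENNReal.mul_inv_cancel _ ENNReal.ofReal_ne_top]
      simpa using Real.exp_pos _
    rw [hpow] at h1
    have h2 := hmgf (-1)
    have h3 : ∫ x, Real.exp (-1 * L x) ∂μ = 1 := by
      rwa [ENNReal.ofReal_eq_one] at h1
    rw [h3, Real.one_le_exp_iff] at h2
    linarith
  have hα1 : 1 < α := hα.lt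
  -- Here `t = α - 1`; mean and variance terms combine as `(α - 1) + (α - 1) ^ 2 = α (α - 1)`.
  have hDα : ∫⁻ x, D x ^ α ∂ν ≤ ENNReal.ofReal (Real.exp (α * ((α - 1) * ((b - a) ^ 2 / 8)))) := by
    have e : ∀ᵐ x ∂ν, D x ^ α = D x * D x ^ (α - 1) := by
      filter_upwards [hν] with x hx
      rw [hx.1, ENNReal.ofReal_rpow_of_pos (Real.exp_pos _),
        ENNReal.ofReal_rpow_of_pos (Real.exp_pos _), ← ENNReal.ofReal_mul (Real.exp_pos _).le,
        ← Real.exp_mul, ← Real.exp_mul, ← Real.exp_add]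
      ring_nf
    rw [lintegral_congr_ae e, hpow]
    refine ENNReal.ofReal_le_ofReal ((hmgf _).trans (Real.exp_le_exp.2 ?_))
    nlinarith [mul_le_mul_of_nonneg_left hm8 (sub_pos.2 hα1).le]
  intro g hg
  rw [← lintegral_rnDeriv_mul hac hg.aemeasurable]
  refine (ENNReal.lintegral_mul_le_Lp_mul_Lq ν hα hDm.aemeasurable hg.aemeasurable).trans ?_
  gcongr
  calc (∫⁻ x, D x ^ α ∂ν) ^ (1 / α)
      ≤ (ENNReal.ofReal (Real.exp (α * ((α - 1) * ((b - a) ^ 2 / 8))))) ^ (1 / α) := by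
        gcongr
    _ = _ := by
        rw [ENNReal.ofReal_rpow_of_pos (Real.exp_pos _), ← Real.exp_mul]
        congr 2
        field_simp [hα.ne_zero]

theorem HolderBound.apply_le {p : ℝ} (hp : 0 < p) {B : ℝ≥0∞} {μ ν : Measure Ω}
    (h : HolderBound p B μ ν) {O : Set Ω} (hO : MeasurableSet O) :
    μ O ≤ B * ν O ^ (1 / p) := by
  have := h (O.indicator 1) (measurable_one.indicator hO)
  have e : (fun x => O.indicator (1 : Ω → ℝ≥0∞) x ^ p) = O.indicator 1 := by
    ext x
    by_cases hx : x ∈ O <;> simp [hx, hp]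
  rwa [e, lintegral_indicator_one hO, lintegral_indicator_one hO] at this

/-- Converse of Hölder's inequality: the extremal test function is `D ^ (α - 1)`. Truncating `D` at
`n` makes its integral finite, so that a factor `I ^ (1 / p)` can be cancelled; monotone convergence
removes the truncation. -/
theorem HolderBound.lintegral_rnDeriv_rpow_le {α p : ℝ} (hα : α.HolderConjugate p) {B : ℝ≥0∞}
    {μ ν : Measure Ω} [IsFiniteMeasure μ] [IsFiniteMeasure ν] (hac : μ ≪ ν)
    (h : HolderBound p B μ ν) : ∫⁻ x, μ.rnDeriv ν x ^ α ∂ν ≤ B ^ α := by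
  set D := μ.rnDeriv ν with hD
  have hDm : Measurable D := Measure.measurable_rnDeriv μ ν
  have hα1 : 1 < α := hα.lt
  have hα0 : 0 < α := hα.pos
  have key : ∀ n : ℕ, ∫⁻ x, (min (D x) n) ^ α ∂ν ≤ B ^ α := by
    intro n
    set I := ∫⁻ x, (min (D x) n) ^ α ∂ν with hI
    have hmm : Measurable fun x => min (D x) (n : ℝ≥0∞) := hDm.min measurable_const
    have hfin : I ≠ ⊤ := by
      refine ne_top_of_le_ne_top ?_ (lintegral_mono (g := fun _ => (n : ℝ≥0∞) ^ α) fun x => ?_)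
      · rw [lintegral_const]
        exact ENNReal.mul_ne_top (ENNReal.rpow_ne_top_of_nonneg hα0.le (ENNReal.natCast_ne_top n))
          (measure_ne_top _ _)
      · exact ENNReal.rpow_le_rpow (min_le_right _ _) hα0.le
    have h1 := h _ (hmm.pow_const (α - 1))
    have e : (fun x => (min (D x) (n : ℝ≥0∞) ^ (α - 1)) ^ p)
        = fun x => min (D x) (n : ℝ≥0∞) ^ α := by
      ext x
      rw [← ENNReal.rpow_mul, hα.sub_one_mul_conj]
    have h2 : I ≤ ∫⁻ x, min (D x) (n : ℝ≥0∞) ^ (α - 1) ∂μ := by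
      rw [← lintegral_rnDeriv_mul hac (hmm.pow_const _).aemeasurable]
      refine lintegral_mono fun x => ?_
      calc min (D x) (n : ℝ≥0∞) ^ α
          = min (D x) (n : ℝ≥0∞) ^ (1 + (α - 1)) := by ring_nf
        _ = min (D x) (n : ℝ≥0∞) * min (D x) (n : ℝ≥0∞) ^ (α - 1) := by
            rw [ENNReal.rpow_add_of_nonneg _ _ zero_le_one (by linarith), ENNReal.rpow_one]
        _ ≤ _ := by gcongr; exact min_le_left _ _
    rw [e] at h1
    have h3 : I ≤ B * I ^ (1 / p) := h2.trans h1
    rcases eq_or_ne I 0 with h0 | h0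
    · rw [h0]; exact zero_le
    have h4 : I ^ (1 / α) ≤ B := by
      have hq : I ^ (1 / p) ≠ 0 := by
        simp [ENNReal.rpow_eq_zero_iff, h0, hfin]
      have hq' : I ^ (1 / p) ≠ ⊤ :=
        ENNReal.rpow_ne_top_of_nonneg (one_div_nonneg.2 hα.symm.nonneg) hfin
      rw [← ENNReal.mul_le_mul_iff_left hq hq', ← ENNReal.rpow_add _ _ h0 hfin]
      simpa [hα.inv_add_inv_eq_one] using h3
    calc I = (I ^ (1 / α)) ^ α := by
          rw [← ENNReal.rpow_mul, one_div_mul_cancel hα0.ne', ENNReal.rpow_one]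
      _ ≤ B ^ α := by gcongr
  have hsup : ∀ x, D x ^ α = ⨆ n : ℕ, (min (D x) n) ^ α := by
    intro x
    have h1 : D x = ⨆ n : ℕ, min (D x) (n : ℝ≥0∞) := by
      rw [← inf_iSup_eq, ENNReal.iSup_natCast, inf_top_eq]
    conv_lhs => rw [h1]
    exact (ENNReal.orderIsoRpow α hα0).map_iSup _
  simp_rw [hsup]
  rw [lintegral_iSup (fun n => (hDm.min measurable_const).pow_const α)
    (fun n m hnm x => by dsimp only; gcongr)]
  exact iSup_le key

theorem HolderBound.renyiDiv_le {α p ρ : ℝ} (hα : α.HolderConjugate p) {μ ν : Measure Ω}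
    [IsFiniteMeasure μ] [IsFiniteMeasure ν]
    (h : HolderBound p (ENNReal.ofReal (Real.exp ((α - 1) * ρ))) μ ν) :
    renyiDiv α μ ν ≤ ((ρ * α : ℝ) : EReal) := by
  have hα1 : 0 < α - 1 := sub_pos.2 hα.lt
  have hac : μ ≪ ν := by
    refine Measure.AbsolutelyContinuous.mk fun s hs h0 => ?_
    have := h.apply_le hα.symm.pos hs
    rwa [h0, ENNReal.zero_rpow_of_pos (one_div_pos.2 hα.symm.pos), mul_zero,
      nonpos_iff_eq_zero] at this
  rw [renyiDiv, if_pos hac]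
  have h1 := h.lintegral_rnDeriv_rpow_le hα hac
  rw [ENNReal.ofReal_rpow_of_pos (Real.exp_pos _), ← Real.exp_mul] at h1
  have h2 : ENNReal.log (∫⁻ x, μ.rnDeriv ν x ^ α ∂ν) ≤ (((α - 1) * ρ * α : ℝ) : EReal) := by
    refine (ENNReal.log_monotone h1).trans_eq ?_
    rw [ENNReal.log_ofReal_of_pos (Real.exp_pos _), Real.log_exp]
  calc _ ≤ (((α - 1)⁻¹ : ℝ) : EReal) * (((α - 1) * ρ * α : ℝ) : EReal) :=
        mul_le_mul_of_nonneg_left h2 (by exact_mod_cast (inv_pos.2 hα1).le)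
    _ = _ := by
        rw [← EReal.coe_mul]
        congr 1
        field_simp

theorem le_add_of_le_mul_rpow {α p ρ ε x y : ℝ} (hα : α.HolderConjugate p) (hx : 0 ≤ x)
    (hy : 0 ≤ y) (h : x ≤ Real.exp ((α - 1) * ρ) * y ^ (1 / p)) :
    x ≤ Real.exp ε * y +
      Real.exp ((α - 1) * (α * ρ - ε)) / (α - 1) * (1 - 1 / α) ^ α := by
  have hα1 : 0 < α - 1 := sub_pos.2 hα.lt
  have hα0 : 0 < α := hα.pos
  have hu : 0 < 1 - 1 / α := by
    rw [sub_pos, div_lt_one hα0]; exact hα.lt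
  rcases hy.eq_or_lt with rfl | hy
  · rw [Real.zero_rpow (one_div_pos.2 hα.symm.pos).ne', mul_zero] at h
    have : 0 ≤ Real.exp ((α - 1) * (α * ρ - ε)) / (α - 1) * (1 - 1 / α) ^ α := by positivity
    linarith
  have hxα : x ^ α ≤ Real.exp ((α - 1) * ρ * α) * y ^ (α - 1) := by
    calc x ^ α ≤ (Real.exp ((α - 1) * ρ) * y ^ (1 / p)) ^ α := by gcongr
      _ = _ := by
          rw [Real.mul_rpow (Real.exp_pos _).le (by positivity), ← Real.exp_mul,
            ← Real.rpow_mul hy.le]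
          congr 2
          have := hα.div_conj_eq_sub_one
          rw [← this]; ring
  set w := x / (y * Real.exp ε) with hw
  have hw0 : 0 ≤ w := by positivity
  -- Bernoulli's inequality is the tangent line of `u ^ α` at `u = 1`, with `u = w (1 - 1 / α)`.
  -- This scaling turns it into `(α - 1) (w - 1) ≤ u ^ α`, which bounds the excess `x - exp ε * y`.
  have hb := one_add_mul_self_le_rpow_one_add (s := w * (1 - 1 / α) - 1)
    (by have : 0 ≤ w * (1 - 1 / α) := by positivity
        linarith) hα.lt.le
  rw [add_sub_cancel, Real.mul_rpow hw0 hu.le] at hb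
  have hb' : (α - 1) * (w - 1) ≤ w ^ α * (1 - 1 / α) ^ α := by
    refine le_trans (le_of_eq ?_) hb
    field_simp
    ring
  have hwα : w ^ α * (y * Real.exp ε) ≤ Real.exp ((α - 1) * (α * ρ - ε)) := by
    rw [hw, Real.div_rpow hx (by positivity), Real.mul_rpow hy.le (Real.exp_pos _).le,
      ← Real.exp_mul]
    have : y ^ α = y ^ (α - 1) * y := by
      rw [← Real.rpow_add_one hy.ne']; ring_nf
    rw [this]
    have hyp : 0 < y ^ (α - 1) := by positivity
    calc x ^ α / (y ^ (α - 1) * y * Real.exp (ε * α)) * (y * Real.exp ε)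
        ≤ (Real.exp ((α - 1) * ρ * α) * y ^ (α - 1)) / (y ^ (α - 1) * y * Real.exp (ε * α))
          * (y * Real.exp ε) := by gcongr
      _ = Real.exp ((α - 1) * ρ * α) * Real.exp ε / Real.exp (ε * α) := by field_simp
      _ = _ := by
          rw [← Real.exp_add, ← Real.exp_sub]; ring_nf
  have hfin : w * (y * Real.exp ε) = x := by rw [hw]; field_simp
  have hpos : 0 < y * Real.exp ε := by positivity
  have h5 : (α - 1) * (x - y * Real.exp ε)
      ≤ Real.exp ((α - 1) * (α * ρ - ε)) * (1 - 1 / α) ^ α := by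
    calc (α - 1) * (x - y * Real.exp ε) = (α - 1) * (w - 1) * (y * Real.exp ε) := by
          rw [← hfin]; ring
      _ ≤ w ^ α * (1 - 1 / α) ^ α * (y * Real.exp ε) := by gcongr
      _ = w ^ α * (y * Real.exp ε) * (1 - 1 / α) ^ α := by ring
      _ ≤ _ := by gcongr
  have h6 : x - y * Real.exp ε
      ≤ Real.exp ((α - 1) * (α * ρ - ε)) * (1 - 1 / α) ^ α / (α - 1) := by
    rw [le_div_iff₀ hα1]; linarith
  rw [div_mul_eq_mul_div]
  linarith

theorem HolderBound.apply_le_exp_mul_add {α p ρ ε : ℝ} (hα : α.HolderConjugate p)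
    {μ ν : Measure Ω} [IsFiniteMeasure μ] [IsFiniteMeasure ν]
    (h : HolderBound p (ENNReal.ofReal (Real.exp ((α - 1) * ρ))) μ ν) {O : Set Ω}
    (hO : MeasurableSet O) :
    μ.real O ≤ Real.exp ε * ν.real O +
      Real.exp ((α - 1) * (α * ρ - ε)) / (α - 1) * (1 - 1 / α) ^ α := by
  refine le_add_of_le_mul_rpow hα measureReal_nonneg measureReal_nonneg ?_
  have h1 := h.apply_le hα.symm.pos hO
  have h2 := ENNReal.toReal_mono (ENNReal.mul_ne_top ENNReal.ofReal_ne_top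
    (ENNReal.rpow_ne_top_of_nonneg (one_div_nonneg.2 hα.symm.nonneg) (measure_ne_top ν O))) h1
  rwa [ENNReal.toReal_mul, ENNReal.toReal_ofReal (Real.exp_pos _).le, ← ENNReal.toReal_rpow] at h2

end HolderBound

/-! ### Laplace noise. -/

section Laplace

theorem measurable_laplaceDensity (b : ℝ) :
    Measurable fun x : ℝ => ENNReal.ofReal (Real.exp (-|x| / b) / (2 * b)) := by
  fun_prop

theorem isProbabilityMeasure_laplace {b : ℝ} (hb : 0 < b) : IsProbabilityMeasure (laplace b) := by
  have h1 : ∫ x in Set.Ioi (0 : ℝ), Real.exp (-x / b) / (2 * b) = 1 / 2 := by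
    have h := integral_exp_mul_Ioi (a := -(1 / b)) (by simpa using hb) 0
    rw [integral_div, show (fun x : ℝ => Real.exp (-x / b)) = fun x => Real.exp (-(1 / b) * x) from
      funext fun x => by ring_nf, h]
    field_simp
    simp
  have h2 : ∫ x : ℝ, Real.exp (-|x| / b) / (2 * b) = 1 := by
    rw [integral_comp_abs (f := fun x => Real.exp (-x / b) / (2 * b)), h1]
    norm_num
  -- The Bochner integral of a non-integrable function is `0` by convention, so the value `1` forces
  -- integrability.
  have hint : Integrable fun x : ℝ => Real.exp (-|x| / b) / (2 * b) := by
    by_contra h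
    rw [integral_undef h] at h2
    exact zero_ne_one h2
  constructor
  rw [laplace, withDensity_apply _ MeasurableSet.univ, Measure.restrict_univ,
    ← ofReal_integral_eq_lintegral_ofReal hint (ae_of_all _ fun x => by positivity), h2,
    ENNReal.ofReal_one]

theorem lintegral_laplace_add_le {b : ℝ} (hb : 0 < b) (δ : ℝ) {g : ℝ → ℝ≥0∞}
    (hg : Measurable g) :
    ∫⁻ x, g (x + δ) ∂laplace b ≤ ENNReal.ofReal (Real.exp (|δ| / b)) * ∫⁻ x, g x ∂laplace b := by
  have hw := measurable_laplaceDensity b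
  have hg' : Measurable fun x => g (x + δ) := hg.comp (measurable_add_const δ)
  rw [laplace, lintegral_withDensity_eq_lintegral_mul _ hw hg',
    lintegral_withDensity_eq_lintegral_mul _ hw hg, ← lintegral_const_mul _ (hw.mul hg),
    ← lintegral_add_right_eq_self (μ := volume)
      (fun x => ENNReal.ofReal (Real.exp (|δ| / b)) *
        ((fun x : ℝ => ENNReal.ofReal (Real.exp (-|x| / b) / (2 * b))) * g) x) δ]
  refine lintegral_mono fun x => ?_
  simp only [Pi.mul_apply]
  rw [← mul_assoc, ← ENNReal.ofReal_mul (Real.exp_pos _).le, ← mul_div_assoc, ← Real.exp_add,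
    ← add_div]
  gcongr
  have := abs_add_le x δ
  linarith

theorem laplace_preimage_add_le {b : ℝ} (hb : 0 < b) (δ : ℝ) {s : Set ℝ} (hs : MeasurableSet s) :
    laplace b {x | x + δ ∈ s} ≤ ENNReal.ofReal (Real.exp (|δ| / b)) * laplace b s := by
  have h := lintegral_laplace_add_le hb δ (measurable_one.indicator hs : Measurable
    (s.indicator (1 : ℝ → ℝ≥0∞)))
  rw [lintegral_indicator_one hs] at h
  refine le_trans (le_of_eq ?_) h
  change laplace b ((fun x => x + δ) ⁻¹' s) = _
  rw [← lintegral_indicator_one (measurable_add_const δ hs)]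
  rfl

/-- The density is positive everywhere. This keeps the chance of another public token away from `1`
and so yields termination. -/
theorem laplace_Iio_lt_one {b : ℝ} (hb : 0 < b) (y : ℝ) : laplace b (Set.Iio y) < 1 := by
  have := isProbabilityMeasure_laplace hb
  have hpos : 0 < laplace b (Set.Ici y) := by
    rw [pos_iff_ne_zero, laplace, Ne, withDensity_apply_eq_zero' (measurable_laplaceDensity b).aemeasurable]
    have : {x : ℝ | ENNReal.ofReal (Real.exp (-|x| / b) / (2 * b)) ≠ 0} ∩ Set.Ici y
        = Set.Ici y := by
      refine Set.inter_eq_right.2 fun x _ => ?_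
      have : 0 < Real.exp (-|x| / b) / (2 * b) := by positivity
      simpa using this
    rw [this]
    simp
  have h := prob_compl_eq_one_sub (μ := laplace b) (measurableSet_Ici (a := y))
  rw [Set.compl_Ici] at h
  rw [h]
  exact ENNReal.sub_lt_self ENNReal.one_ne_top one_ne_zero hpos.ne'

end Laplace

/-! ### Sensitivity of softmax, aggregated logits and distance. -/

section Sensitivity

variable {V : Type*} [Fintype V]

theorem softmax_nonneg (z : V → ℝ) (i : V) : 0 ≤ softmax z i := by
  unfold softmax; positivity

theorem sum_softmax [Nonempty V] (z : V → ℝ) : ∑ i, softmax z i = 1 := by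
  unfold softmax
  rw [← Finset.sum_div, div_self]
  exact (Finset.sum_pos (fun i _ => Real.exp_pos _) Finset.univ_nonempty).ne'

theorem sum_ofReal_softmax [Nonempty V] (z : V → ℝ) : ∑ i, ENNReal.ofReal (softmax z i) = 1 := by
  rw [← ENNReal.ofReal_sum_of_nonneg fun i _ => softmax_nonneg z i, sum_softmax,
    ENNReal.ofReal_one]

/-- Perturbing logits by at most `Δ` changes all log-probabilities by a common constant up to an
error `Δ`. -/
theorem exists_softmax_bounds [Nonempty V] {z z' : V → ℝ} {Δ : ℝ}
    (h : ∀ i, |z i - z' i| ≤ Δ) :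
    ∃ κ : ℝ, ∀ i, Real.exp (κ - Δ) * softmax z' i ≤ softmax z i ∧
      softmax z i ≤ Real.exp (κ + Δ) * softmax z' i := by
  have hN : 0 < ∑ j, Real.exp (z j) :=
    Finset.sum_pos (fun i _ => Real.exp_pos _) Finset.univ_nonempty
  have hN' : 0 < ∑ j, Real.exp (z' j) :=
    Finset.sum_pos (fun i _ => Real.exp_pos _) Finset.univ_nonempty
  -- `κ` is the change of the log-normalizer. Since only the length of the interval matters later,
  -- it costs nothing, although it may itself be as large as `Δ`.
  refine ⟨Real.log (∑ j, Real.exp (z' j)) - Real.log (∑ j, Real.exp (z j)), fun i => ?_⟩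
  have e : ∀ y : V → ℝ, 0 < ∑ j, Real.exp (y j) →
      softmax y i = Real.exp (y i - Real.log (∑ j, Real.exp (y j))) := fun y hy => by
    rw [softmax, Real.exp_sub, Real.exp_log hy]
  rw [e z hN, e z' hN', ← Real.exp_add, ← Real.exp_add, Real.exp_le_exp, Real.exp_le_exp]
  have := abs_le.1 (h i)
  constructor <;> linarith

theorem abs_clip_le {c : ℝ} (hc : 0 ≤ c) (z : V → ℝ) (i : V) : |clip c z i| ≤ c := by
  have h : z i ≤ ⨆ j, z j := le_ciSup (Set.finite_range z).bddAbove i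
  rw [abs_le, clip]
  exact ⟨le_max_left _ _, max_le (by linarith) (by linarith)⟩

/-- The factor `1 / s` does not depend on the size of `Z`, so one clipped vector is the whole
change. The vector may already be in `Z`, as distinct prompts can share logits; then nothing
changes. -/
theorem abs_aggregate_insert_sub_le [DecidableEq (V → ℝ)] {c s : ℝ} (hc : 0 ≤ c) (hs : 0 < s)
    (Z : Finset (V → ℝ)) (z : V → ℝ) (i : V) :
    |aggregate c s (insert z Z) i - aggregate c s Z i| ≤ c / s := by
  by_cases hz : z ∈ Z
  · rw [Finset.insert_eq_of_mem hz, sub_self, abs_zero]; positivity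
  · rw [aggregate, aggregate, Finset.sum_insert hz, mul_add, add_sub_cancel_right, abs_mul,
      abs_of_pos (one_div_pos.2 hs), one_div_mul_eq_div]
    gcongr
    exact abs_clip_le hc z i

theorem abs_dist₁_insert_sub_le [DecidableEq (V → ℝ)] [Nonempty V] {s : ℝ} (hs : 0 < s)
    (Z : Finset (V → ℝ)) (z zpub : V → ℝ) :
    |dist₁ s (insert z Z) zpub - dist₁ s Z zpub| ≤ 1 / s := by
  by_cases hz : z ∈ Z
  · rw [Finset.insert_eq_of_mem hz, sub_self, abs_zero]; positivity
  · rw [dist₁, dist₁, ← Finset.sum_sub_distrib]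
    calc _ ≤ ∑ i, 1 / s * softmax z i := by
          refine (Finset.abs_sum_le_sum_abs _ _).trans (Finset.sum_le_sum fun i _ => ?_)
          refine (abs_abs_sub_abs_le _ _).trans_eq ?_
          rw [Finset.sum_insert hz]
          have := softmax_nonneg z i
          rw [show ∀ u v w x : ℝ, u * (v + w) - x - (u * w - x) = u * v from
            fun u v w x => by ring, abs_of_nonneg (by positivity)]
      _ = 1 / s := by rw [← Finset.mul_sum, sum_softmax, mul_one]

theorem dist₁_nonneg (s : ℝ) (Z : Finset (V → ℝ)) (zpub : V → ℝ) : 0 ≤ dist₁ s Z zpub :=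
  Finset.sum_nonneg fun _ _ => abs_nonneg _

/-- The quantities that depend on the batch differ by at most the sensitivity bounds. -/
def CloseBatches (A : Params V) (S S' : Finset (List V)) : Prop :=
  ∀ x : List V,
    (∀ i, |aggregate A.c A.s (batchLogits A S x) i - aggregate A.c A.s (batchLogits A S' x) i|
      ≤ A.c / A.s) ∧
    |dist₁ A.s (batchLogits A S x) (pubLogits A x) -
      dist₁ A.s (batchLogits A S' x) (pubLogits A x)| ≤ 1 / A.s

theorem CloseBatches.symm {A : Params V} {S S' : Finset (List V)} (h : CloseBatches A S S') :
    CloseBatches A S' S := fun x =>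
  ⟨fun i => by rw [abs_sub_comm]; exact (h x).1 i, by rw [abs_sub_comm]; exact (h x).2⟩

theorem closeBatches_insert [DecidableEq (List V)] (A : Params V) (hs : 0 < A.s) (hc : 0 ≤ A.c)
    (S : Finset (List V)) (p : List V) : CloseBatches A (insert p S) S := by
  classical
  have : Nonempty V := ⟨A.eos⟩
  intro x
  have e : batchLogits A (insert p S) x = insert (A.logits (p ++ x)) (batchLogits A S x) := by
    unfold batchLogits
    convert Finset.image_insert _ _ _
  rw [e]
  exact ⟨abs_aggregate_insert_sub_le hc hs _ _, abs_dist₁_insert_sub_le hs _ _ _⟩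

end Sensitivity

@[simp] theorem Config.append_t {V : Type*} [DecidableEq V] (A : Params V) (q : Config V) (a : V)
    (t' : ℕ) : (q.append A a t').t = t' := by
  unfold Config.append
  split_ifs <;> rfl

/-! ### Integrals against one transition of the token loop. -/

section OneStep

variable {V : Type*} [Fintype V]

/-- The probability that the next token is private, given the noisy threshold. -/
noncomputable def privProb (A : Params V) (S : Finset (List V)) (θ' : ℝ) (q : Config V) : ℝ≥0∞ :=
  laplace (2 * A.σ) {ξ | θ' ≤ dist₁ A.s (batchLogits A S q.x) (pubLogits A q.x) + ξ}

/-- The probability that the next token is public, given the noisy threshold. -/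
noncomputable def pubProb (A : Params V) (S : Finset (List V)) (θ' : ℝ) (q : Config V) : ℝ≥0∞ :=
  laplace (2 * A.σ) {ξ | dist₁ A.s (batchLogits A S q.x) (pubLogits A q.x) + ξ < θ'}

/-- The probability of drawing the token `a` in the private branch. -/
noncomputable def privWeight (A : Params V) (S : Finset (List V)) (q : Config V) (a : V) : ℝ≥0∞ :=
  ENNReal.ofReal (softmax (fun i => aggregate A.c A.s (batchLogits A S q.x) i / A.τ) a)

/-- The probability of drawing the token `a` in the public branch. -/
noncomputable def pubWeight (A : Params V) (q : Config V) (a : V) : ℝ≥0∞ :=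
  ENNReal.ofReal (softmax (fun i => pubLogits A q.x i / A.τpub) a)

variable (A : Params V) (S : Finset (List V))

theorem sum_privWeight (q : Config V) : ∑ a, privWeight A S q a = 1 :=
  have : Nonempty V := ⟨A.eos⟩
  sum_ofReal_softmax _

theorem sum_pubWeight (q : Config V) : ∑ a, pubWeight A q a = 1 :=
  have : Nonempty V := ⟨A.eos⟩
  sum_ofReal_softmax _

theorem measurableSet_private (θ' : ℝ) (q : Config V) :
    MeasurableSet {ξ | θ' ≤ dist₁ A.s (batchLogits A S q.x) (pubLogits A q.x) + ξ} :=
  measurableSet_le measurable_const (measurable_const.add measurable_id)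

theorem compl_private (θ' : ℝ) (q : Config V) :
    {ξ | θ' ≤ dist₁ A.s (batchLogits A S q.x) (pubLogits A q.x) + ξ}ᶜ
      = {ξ | dist₁ A.s (batchLogits A S q.x) (pubLogits A q.x) + ξ < θ'} := by
  ext ξ
  simp

theorem privProb_add_pubProb (hσ : 0 < A.σ) (θ' : ℝ) (q : Config V) :
    privProb A S θ' q + pubProb A S θ' q = 1 := by
  have := isProbabilityMeasure_laplace (b := 2 * A.σ) (by positivity)
  rw [privProb, pubProb, ← compl_private]
  exact prob_add_prob_compl (measurableSet_private A S θ' q)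

theorem measurable_privProb (q : Config V) : Measurable fun θ' => privProb A S θ' q :=
  Antitone.measurable fun _ _ h => measure_mono fun _ hξ => h.trans hξ

theorem measurable_pubProb (q : Config V) : Measurable fun θ' => pubProb A S θ' q :=
  Monotone.measurable fun _ _ h => measure_mono fun _ hξ => lt_of_lt_of_le hξ h

theorem pubProb_le (θ' : ℝ) (q : Config V) :
    pubProb A S θ' q ≤ laplace (2 * A.σ) (Set.Iio θ') := by
  refine measure_mono fun ξ hξ => ?_
  have := dist₁_nonneg A.s (batchLogits A S q.x) (pubLogits A q.x)
  simp only [Set.mem_ofPred_eq, Set.mem_Iio] at hξ ⊢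
  linarith

variable [DecidableEq V]

theorem lintegral_privateLaw (q : Config V) {g : State V → ℝ≥0∞} (hg : Measurable g) :
    ∫⁻ y, g y ∂privateLaw A S q
      = ∑ a, privWeight A S q a * ∫⁻ η, g (A.θ + η, q.append A a (q.t + 1)) ∂laplace A.σ := by
  rw [privateLaw, lintegral_finsetSum_measure]
  refine Finset.sum_congr rfl fun a _ => ?_
  rw [lintegral_smul_measure, lintegral_map hg (by fun_prop)]
  rfl

theorem lintegral_publicLaw (q : Config V) (θ' : ℝ) {g : State V → ℝ≥0∞} (hg : Measurable g) :
    ∫⁻ y, g y ∂publicLaw A q θ' = ∑ a, pubWeight A q a * g (θ', q.append A a q.t) := by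
  rw [publicLaw, lintegral_finsetSum_measure]
  refine Finset.sum_congr rfl fun a _ => ?_
  rw [lintegral_smul_measure, lintegral_dirac' _ hg]
  rfl

theorem lintegral_stepLaw_of_le {q : Config V} (hq : A.r ≤ q.t) (θ' : ℝ) {g : State V → ℝ≥0∞}
    (hg : Measurable g) : ∫⁻ y, g y ∂stepLaw A S (θ', q) = g (θ', q) := by
  rw [stepLaw, if_pos hq, lintegral_dirac' _ hg]

theorem lintegral_stepLaw_of_lt {q : Config V} (hq : q.t < A.r) (θ' : ℝ) {g : State V → ℝ≥0∞}
    (hg : Measurable g) :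
    ∫⁻ y, g y ∂stepLaw A S (θ', q) =
      privProb A S θ' q * (∑ a, privWeight A S q a *
        ∫⁻ η, g (A.θ + η, q.append A a (q.t + 1)) ∂laplace A.σ) +
      pubProb A S θ' q * ∑ a, pubWeight A q a * g (θ', q.append A a q.t) := by
  have hA := measurableSet_private A S θ' q
  rw [stepLaw, if_neg (not_le.2 hq), Measure.lintegral_bind
    (Measurable.ite hA measurable_const measurable_const).aemeasurable hg.aemeasurable,
    ← lintegral_add_compl _ hA]
  congr 1
  · rw [setLIntegral_congr_fun (g := fun _ => ∫⁻ y, g y ∂privateLaw A S q) hA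
      (fun ξ hξ => by
        have h : θ' ≤ dist₁ A.s (batchLogits A S q.x) (pubLogits A q.x) + ξ := hξ
        simp only [if_pos h]), setLIntegral_const, mul_comm,
      lintegral_privateLaw A S q hg]
    rfl
  · rw [setLIntegral_congr_fun (g := fun _ => ∫⁻ y, g y ∂publicLaw A q θ') hA.compl
      (fun ξ hξ => by
        have h : ¬θ' ≤ dist₁ A.s (batchLogits A S q.x) (pubLogits A q.x) + ξ := hξ
        simp only [if_neg h]), setLIntegral_const, mul_comm,
      lintegral_publicLaw A q θ' hg, compl_private]
    rfl

end OneStep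

/-! ### Expected payoffs and their one-step equation. -/

section Value

/-- The payoff `F` of the generated examples in a halted state, and `0` in a running state. -/
noncomputable def haltPayoff {V : Type*} (A : Params V) (F : Finset (List V) → ℝ≥0∞) (st : State V) : ℝ≥0∞ :=
  if A.r ≤ st.2.t then F st.2.X else 0

theorem measurable_haltPayoff {V : Type*} (A : Params V)
    (F : Finset (List V) → ℝ≥0∞) : Measurable (haltPayoff A F) :=
  (Measurable.of_discrete (f := fun q : Config V => if A.r ≤ q.t then F q.X else 0)).comp
    measurable_snd

variable {V : Type*} [Fintype V] [DecidableEq V]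

/-- The expected payoff after `n` iterations of the token loop. -/
noncomputable def valueAt (A : Params V) (S : Finset (List V)) (F : Finset (List V) → ℝ≥0∞)
    (n : ℕ) (st : State V) : ℝ≥0∞ :=
  ∫⁻ y, haltPayoff A F y ∂steps A S n st

/-- The expected payoff of the program started in a given state. -/
noncomputable def value (A : Params V) (S : Finset (List V)) (F : Finset (List V) → ℝ≥0∞)
    (st : State V) : ℝ≥0∞ :=
  ⨆ n, valueAt A S F n st

/-- The expected payoff of the program started in a given configuration with a freshly drawn
threshold. -/
noncomputable def freshValue (A : Params V) (S : Finset (List V)) (F : Finset (List V) → ℝ≥0∞)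
    (q : Config V) : ℝ≥0∞ :=
  ∫⁻ η, value A S F (A.θ + η, q) ∂laplace A.σ

/-- The expected payoff of the program at the moment when a private token is about to be drawn. -/
noncomputable def privateValue (A : Params V) (S : Finset (List V)) (F : Finset (List V) → ℝ≥0∞)
    (q : Config V) : ℝ≥0∞ :=
  ∑ a, privWeight A S q a * freshValue A S F (q.append A a (q.t + 1))

variable (A : Params V) (S : Finset (List V)) (F : Finset (List V) → ℝ≥0∞)

theorem measurable_valueAt (n : ℕ) : Measurable (valueAt A S F n) :=
  (measurable_haltPayoff A F).lintegral_kernel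

theorem measurable_value : Measurable (value A S F) :=
  Measurable.iSup fun n => measurable_valueAt A S F n

/-- `steps` adds iterations at the end, whereas recursion for the payoff conditions on the first
one. -/
theorem steps_succ' (n : ℕ) : steps A S (n + 1) = steps A S n ∘ₖ step A S := by
  induction n with
  | zero => simp [steps]
  | succ n ih =>
    change step A S ∘ₖ steps A S (n + 1) = (step A S ∘ₖ steps A S n) ∘ₖ step A S
    rw [ih, Kernel.comp_assoc]

theorem valueAt_zero (st : State V) : valueAt A S F 0 st = haltPayoff A F st := by
  rw [valueAt, steps, Kernel.id_apply, lintegral_dirac' _ (measurable_haltPayoff A F)]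

theorem valueAt_succ (n : ℕ) (st : State V) :
    valueAt A S F (n + 1) st = ∫⁻ y, valueAt A S F n y ∂stepLaw A S st := by
  rw [valueAt, steps_succ', Kernel.lintegral_comp _ _ _ (measurable_haltPayoff A F)]
  rfl

theorem valueAt_of_le {q : Config V} (hq : A.r ≤ q.t) (θ' : ℝ) (n : ℕ) :
    valueAt A S F n (θ', q) = F q.X := by
  induction n with
  | zero => rw [valueAt_zero, haltPayoff, if_pos hq]
  | succ n ih =>
    rw [valueAt_succ, lintegral_stepLaw_of_le A S hq _ (measurable_valueAt A S F n), ih]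

theorem valueAt_mono (st : State V) : Monotone fun n => valueAt A S F n st := by
  refine monotone_nat_of_le_succ fun n => ?_
  induction n generalizing st with
  | zero =>
    obtain ⟨θ', q⟩ := st
    by_cases hq : A.r ≤ q.t
    · rw [valueAt_of_le A S F hq, valueAt_of_le A S F hq]
    · rw [valueAt_zero, haltPayoff, if_neg hq]
      exact zero_le
  | succ n ih =>
    rw [valueAt_succ, valueAt_succ A S F (n + 1)]
    exact lintegral_mono ih

theorem freshValue_of_le (hσ : 0 < A.σ) {q : Config V} (hq : A.r ≤ q.t) :
    freshValue A S F q = F q.X := by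
  have := isProbabilityMeasure_laplace hσ
  simp [freshValue, value, valueAt_of_le A S F hq]

theorem freshValue_eq_iSup (q : Config V) :
    freshValue A S F q = ⨆ n, ∫⁻ η, valueAt A S F n (A.θ + η, q) ∂laplace A.σ :=
  lintegral_iSup (fun n => (measurable_valueAt A S F n).comp (by fun_prop))
    fun _ _ h _ => valueAt_mono A S F _ h

theorem value_of_lt {q : Config V} (hq : q.t < A.r) (θ' : ℝ) :
    value A S F (θ', q) = privProb A S θ' q * privateValue A S F q +
      pubProb A S θ' q * ∑ a, pubWeight A q a * value A S F (θ', q.append A a q.t) := by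
  have hmono : ∀ q', Monotone fun n => ∫⁻ η, valueAt A S F n (A.θ + η, q') ∂laplace A.σ :=
    fun q' _ _ h => lintegral_mono fun η => valueAt_mono A S F _ h
  have e : value A S F (θ', q) = ⨆ n, valueAt A S F (n + 1) (θ', q) :=
    ((valueAt_mono A S F (θ', q)).iSup_nat_add 1).symm
  simp_rw [e, valueAt_succ, lintegral_stepLaw_of_lt A S hq θ' (measurable_valueAt A S F _),
    privateValue, freshValue_eq_iSup, value, ENNReal.mul_iSup]
  rw [ENNReal.finsetSum_iSup_of_monotone, ENNReal.finsetSum_iSup_of_monotone, ENNReal.mul_iSup,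
    ENNReal.mul_iSup, ENNReal.iSup_add_iSup_of_monotone]
  · intro m n h
    dsimp only
    exact mul_le_mul_right (Finset.sum_le_sum fun a _ => mul_le_mul_right (hmono _ h) _) _
  · intro m n h
    dsimp only
    gcongr
    exact valueAt_mono A S F _ h
  · intro a m n h
    dsimp only
    gcongr
    exact valueAt_mono A S F _ h
  · intro a m n h
    dsimp only
    exact mul_le_mul_right (hmono _ h) _

end Value

/-! ### One round: the sparse vector technique. -/

section Round

variable {V : Type*} [Fintype V] [DecidableEq V]

/-- The (sub-probability) law of the configuration in which a private token is drawn, on the event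
that exactly `n` public tokens are drawn before, for a given noisy threshold. -/
noncomputable def stopLaw (A : Params V) (S : Finset (List V)) :
    ℕ → ℝ → Config V → Measure (Config V)
  | 0, θ', q => privProb A S θ' q • Measure.dirac q
  | n + 1, θ', q => pubProb A S θ' q •
      ∑ a, pubWeight A q a • stopLaw A S n θ' (q.append A a q.t)

/-- The law of the configuration in which the next private token is drawn, for a freshly drawn
threshold. -/
noncomputable def roundLaw (A : Params V) (S : Finset (List V)) (q : Config V) :
    Measure (Config V) :=
  (laplace A.σ).bind fun η => Measure.sum fun n => stopLaw A S n (A.θ + η) q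

variable (A : Params V) (S : Finset (List V))

theorem lintegral_stopLaw_zero (g : Config V → ℝ≥0∞) (θ' : ℝ) (q : Config V) :
    ∫⁻ y, g y ∂stopLaw A S 0 θ' q = privProb A S θ' q * g q := by
  rw [stopLaw, lintegral_smul_measure, lintegral_dirac]
  rfl

theorem lintegral_stopLaw_succ (g : Config V → ℝ≥0∞) (n : ℕ) (θ' : ℝ) (q : Config V) :
    ∫⁻ y, g y ∂stopLaw A S (n + 1) θ' q = pubProb A S θ' q *
      ∑ a, pubWeight A q a * ∫⁻ y, g y ∂stopLaw A S n θ' (q.append A a q.t) := by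
  rw [stopLaw, lintegral_smul_measure, lintegral_finsetSum_measure]
  simp_rw [lintegral_smul_measure]
  rfl

theorem measurable_lintegral_stopLaw (g : Config V → ℝ≥0∞) (n : ℕ) (q : Config V) :
    Measurable fun θ' => ∫⁻ y, g y ∂stopLaw A S n θ' q := by
  induction n generalizing q with
  | zero =>
    simp_rw [lintegral_stopLaw_zero]
    exact (measurable_privProb A S q).mul_const _
  | succ n ih =>
    simp_rw [lintegral_stopLaw_succ]
    exact (measurable_pubProb A S q).mul
      (Finset.measurable_sum _ fun a _ => (ih _).const_mul _)

theorem measurable_sum_stopLaw (q : Config V) :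
    Measurable fun θ' => Measure.sum fun n => stopLaw A S n θ' q := by
  refine Measure.measurable_of_measurable_coe _ fun s hs => ?_
  simp_rw [Measure.sum_apply _ hs, ← lintegral_indicator_one hs]
  exact Measurable.tsum fun n => measurable_lintegral_stopLaw A S _ n q

theorem lintegral_roundLaw (g : Config V → ℝ≥0∞) (q : Config V) :
    ∫⁻ y, g y ∂roundLaw A S q
      = ∫⁻ η, ∑' n, ∫⁻ y, g y ∂stopLaw A S n (A.θ + η) q ∂laplace A.σ := by
  have hm : Measurable fun η => Measure.sum fun n => stopLaw A S n (A.θ + η) q :=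
    (measurable_sum_stopLaw A S q).comp (measurable_const_add A.θ)
  rw [roundLaw, Measure.lintegral_bind hm.aemeasurable Measurable.of_discrete.aemeasurable]
  simp_rw [lintegral_sum_measure]

/-- Conditions on the number of public tokens before the next private one. Finite-horizon values lie
below the series, and its partial sums lie below `value` by unrolling `value_of_lt`. -/
theorem value_eq_tsum (F : Finset (List V) → ℝ≥0∞) {q : Config V} (hq : q.t < A.r) (θ' : ℝ) :
    value A S F (θ', q) = ∑' n, ∫⁻ y, privateValue A S F y ∂stopLaw A S n θ' q := by
  refine le_antisymm (iSup_le fun n => ?_) ?_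
  · induction n generalizing q with
    | zero =>
      rw [valueAt_zero, haltPayoff, if_neg (not_le.2 hq)]
      exact zero_le
    | succ n ih =>
      rw [valueAt_succ, lintegral_stepLaw_of_lt A S hq θ' (measurable_valueAt A S F n),
        tsum_eq_zero_add' ENNReal.summable, lintegral_stopLaw_zero]
      simp_rw [lintegral_stopLaw_succ, ENNReal.tsum_mul_left]
      rw [Summable.tsum_finsetSum fun _ _ => ENNReal.summable]
      simp_rw [ENNReal.tsum_mul_left, privateValue, freshValue]
      gcongr with a _ a _
      · exact le_iSup (fun n => valueAt A S F n _) n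
      · exact ih (by simpa using hq)
  · rw [ENNReal.tsum_eq_iSup_nat]
    refine iSup_le fun N => ?_
    induction N generalizing q with
    | zero => simp
    | succ N ih =>
      rw [Finset.sum_range_succ', lintegral_stopLaw_zero, value_of_lt A S F hq, add_comm]
      simp_rw [lintegral_stopLaw_succ]
      rw [← Finset.mul_sum, Finset.sum_comm]
      simp_rw [← Finset.mul_sum]
      gcongr with a _
      exact ih (by simpa using hq)

theorem freshValue_of_lt (F : Finset (List V) → ℝ≥0∞) {q : Config V} (hq : q.t < A.r) :
    freshValue A S F q = ∫⁻ y, privateValue A S F y ∂roundLaw A S q := by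
  rw [lintegral_roundLaw]
  exact lintegral_congr fun η => value_eq_tsum A S F hq _

theorem sum_stopLaw_univ_le_one (hσ : 0 < A.σ) (N : ℕ) (θ' : ℝ) (q : Config V) :
    ∑ n ∈ Finset.range N, ∫⁻ _, 1 ∂stopLaw A S n θ' q ≤ 1 := by
  induction N generalizing q with
  | zero => simp
  | succ N ih =>
    rw [Finset.sum_range_succ', lintegral_stopLaw_zero, add_comm, mul_one]
    simp_rw [lintegral_stopLaw_succ]
    rw [← Finset.mul_sum, Finset.sum_comm]
    simp_rw [← Finset.mul_sum]
    calc _ ≤ privProb A S θ' q + pubProb A S θ' q * ∑ a, pubWeight A q a * 1 := by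
          gcongr with a _; exact ih _
      _ = 1 := by
          simp_rw [mul_one, sum_pubWeight, mul_one, privProb_add_pubProb A S hσ]

/-- For a fixed threshold each public test succeeds with probability at most that of `Set.Iio θ'`,
uniformly in the configuration because distances are nonnegative; surviving `N` tests is
geometrically unlikely. -/
theorem one_le_sum_stopLaw_univ_add (hσ : 0 < A.σ) (N : ℕ) (θ' : ℝ) (q : Config V) :
    1 ≤ ∑ n ∈ Finset.range N, ∫⁻ _, 1 ∂stopLaw A S n θ' q
      + laplace (2 * A.σ) (Set.Iio θ') ^ N := by
  induction N generalizing q with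
  | zero => simp
  | succ N ih =>
    set m := laplace (2 * A.σ) (Set.Iio θ')
    rw [Finset.sum_range_succ', lintegral_stopLaw_zero, mul_one]
    simp_rw [lintegral_stopLaw_succ]
    rw [← Finset.mul_sum, Finset.sum_comm]
    simp_rw [← Finset.mul_sum]
    calc 1 = privProb A S θ' q + pubProb A S θ' q * ∑ a, pubWeight A q a * 1 := by
          simp_rw [mul_one, sum_pubWeight, mul_one, privProb_add_pubProb A S hσ]
      _ ≤ privProb A S θ' q + pubProb A S θ' q * ∑ a, pubWeight A q a *
            (∑ n ∈ Finset.range N, ∫⁻ _, 1 ∂stopLaw A S n θ' (q.append A a q.t) + m ^ N) := by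
          gcongr with a _; exact ih _
      _ = pubProb A S θ' q * (∑ a, pubWeight A q a *
            ∑ n ∈ Finset.range N, ∫⁻ _, 1 ∂stopLaw A S n θ' (q.append A a q.t))
          + privProb A S θ' q + pubProb A S θ' q * m ^ N := by
          simp_rw [mul_add, Finset.sum_add_distrib, ← Finset.sum_mul, sum_pubWeight, one_mul]
          ring
      _ ≤ _ := by
          rw [pow_succ']
          gcongr
          exact pubProb_le A S θ' q

theorem tsum_stopLaw_univ (hσ : 0 < A.σ) (θ' : ℝ) (q : Config V) :
    ∑' n, ∫⁻ _, 1 ∂stopLaw A S n θ' q = 1 := by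
  refine le_antisymm ?_ ?_
  · rw [ENNReal.tsum_eq_iSup_nat]
    exact iSup_le fun N => sum_stopLaw_univ_le_one A S hσ N θ' q
  · have h := (tendsto_const_nhds (x := ∑' n, ∫⁻ _, 1 ∂stopLaw A S n θ' q)).add
      (ENNReal.tendsto_pow_atTop_nhds_zero_of_lt_one
        (laplace_Iio_lt_one (b := 2 * A.σ) (by positivity) θ'))
    rw [add_zero] at h
    refine ge_of_tendsto' h fun N => ?_
    refine (one_le_sum_stopLaw_univ_add A S hσ N θ' q).trans ?_
    gcongr
    exact ENNReal.sum_le_tsum _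

theorem isProbabilityMeasure_roundLaw (hσ : 0 < A.σ) (q : Config V) :
    IsProbabilityMeasure (roundLaw A S q) := by
  have := isProbabilityMeasure_laplace hσ
  constructor
  rw [← lintegral_one, lintegral_roundLaw]
  simp_rw [tsum_stopLaw_univ A S hσ]
  simp

theorem lintegral_stopLaw_ite (g : Config V → ℝ≥0∞) (n : ℕ) (θ' : ℝ) (q : Config V) :
    ∫⁻ y, (if y.t = q.t then 0 else g y) ∂stopLaw A S n θ' q = 0 := by
  induction n generalizing q with
  | zero => simp [lintegral_stopLaw_zero]
  | succ n ih =>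
    rw [lintegral_stopLaw_succ, Finset.sum_eq_zero, mul_zero]
    intro a _
    have := ih (q.append A a q.t)
    rw [Config.append_t] at this
    rw [this, mul_zero]

theorem ae_roundLaw_t_eq (q : Config V) : ∀ᵐ y ∂roundLaw A S q, y.t = q.t := by
  have h : ∫⁻ y, (if y.t = q.t then 0 else 1) ∂roundLaw A S q = 0 := by
    rw [lintegral_roundLaw]
    simp_rw [lintegral_stopLaw_ite, tsum_zero, lintegral_zero]
  rw [lintegral_eq_zero_iff Measurable.of_discrete] at h
  filter_upwards [h] with y hy
  by_contra hne
  simp [hne] at hy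

variable {A S} {S' : Finset (List V)}

/-- The raised threshold absorbs the change of distance in every public test, so those factors only
grow. The exponential factor is paid once, in the final private test, independently of `n`. -/
theorem lintegral_stopLaw_le_add (hs : 0 < A.s) (hσ : 0 < A.σ) (h : CloseBatches A S S')
    (g : Config V → ℝ≥0∞) (n : ℕ) (θ' : ℝ) (q : Config V) :
    ∫⁻ y, g y ∂stopLaw A S n θ' q ≤ ENNReal.ofReal (Real.exp (1 / (A.s * A.σ))) *
      ∫⁻ y, g y ∂stopLaw A S' n (θ' + 1 / A.s) q := by
  have hσ2 : 0 < 2 * A.σ := by positivity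
  induction n generalizing q with
  | zero =>
    rw [lintegral_stopLaw_zero, lintegral_stopLaw_zero, ← mul_assoc]
    gcongr
    have hd := abs_le.1 (h q.x).2
    -- The noise must compensate `1 / s` for the raised threshold and `1 / s` for the distance; at
    -- scale `2 σ` this costs `1 / (s σ)`.
    have h1 := laplace_preimage_add_le hσ2 (2 * (1 / A.s))
      (measurableSet_private A S' (θ' + 1 / A.s) q)
    refine (measure_mono fun ξ hξ => ?_).trans (h1.trans_eq ?_)
    · simp only [Set.mem_ofPred_eq] at hξ ⊢
      linarith
    · rw [abs_of_pos (by positivity), privProb]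
      congr 3
      field_simp
  | succ n ih =>
    rw [lintegral_stopLaw_succ, lintegral_stopLaw_succ]
    have hp : pubProb A S θ' q ≤ pubProb A S' (θ' + 1 / A.s) q := by
      have hd := abs_le.1 (h q.x).2
      refine measure_mono fun ξ hξ => ?_
      simp only [Set.mem_ofPred_eq] at hξ ⊢
      linarith
    calc _ ≤ pubProb A S' (θ' + 1 / A.s) q * ∑ a, pubWeight A q a *
          (ENNReal.ofReal (Real.exp (1 / (A.s * A.σ))) *
            ∫⁻ y, g y ∂stopLaw A S' n (θ' + 1 / A.s) (q.append A a q.t)) := by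
          gcongr with a _; exact ih _
      _ = _ := by
          simp_rw [mul_left_comm (pubWeight A q _), ← Finset.mul_sum]
          rw [mul_left_comm]

/-- Half of the exponent comes from the private test, the other half from translating the threshold
noise, of scale `σ`, by `1 / s`. -/
theorem roundLaw_le_smul (hs : 0 < A.s) (hσ : 0 < A.σ) (h : CloseBatches A S S')
    (q : Config V) :
    roundLaw A S q ≤ ENNReal.ofReal (Real.exp (2 / (A.s * A.σ))) • roundLaw A S' q := by
  refine Measure.le_iff.2 fun O hO => ?_
  rw [Measure.smul_apply, smul_eq_mul, ← lintegral_indicator_one hO, ← lintegral_indicator_one hO,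
    lintegral_roundLaw, lintegral_roundLaw]
  set g : Config V → ℝ≥0∞ := O.indicator 1
  have hm : ∀ S, Measurable fun η => ∑' n, ∫⁻ y, g y ∂stopLaw A S n (A.θ + η) q := fun S =>
    Measurable.tsum fun n =>
      (measurable_lintegral_stopLaw A S g n q).comp (measurable_const_add A.θ)
  calc ∫⁻ η, ∑' n, ∫⁻ y, g y ∂stopLaw A S n (A.θ + η) q ∂laplace A.σ
      ≤ ∫⁻ η, ENNReal.ofReal (Real.exp (1 / (A.s * A.σ))) *
          ∑' n, ∫⁻ y, g y ∂stopLaw A S' n (A.θ + (η + 1 / A.s)) q ∂laplace A.σ := by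
        refine lintegral_mono fun η => ?_
        rw [← ENNReal.tsum_mul_left, ← add_assoc]
        exact ENNReal.tsum_le_tsum fun n => lintegral_stopLaw_le_add hs hσ h g n _ q
    _ = ENNReal.ofReal (Real.exp (1 / (A.s * A.σ))) *
          ∫⁻ η, ∑' n, ∫⁻ y, g y ∂stopLaw A S' n (A.θ + (η + 1 / A.s)) q ∂laplace A.σ :=
        lintegral_const_mul _ ((hm S').comp (measurable_add_const _))
    _ ≤ ENNReal.ofReal (Real.exp (1 / (A.s * A.σ))) *
          (ENNReal.ofReal (Real.exp (|1 / A.s| / A.σ)) *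
            ∫⁻ η, ∑' n, ∫⁻ y, g y ∂stopLaw A S' n (A.θ + η) q ∂laplace A.σ) := by
        gcongr
        exact lintegral_laplace_add_le hσ (1 / A.s) (hm S')
    _ = _ := by
        rw [← mul_assoc, ← ENNReal.ofReal_mul (Real.exp_pos _).le, ← Real.exp_add,
          abs_of_pos (by positivity)]
        congr 3
        field_simp
        norm_num

end Round

/-! ### Composition over rounds and batches. -/

section Batch

variable {V : Type*} [Fintype V]

theorem sum_privWeight_mul_le {α p : ℝ} (hα : α.HolderConjugate p) {A : Params V}
    {S S' : Finset (List V)} (hτ : 0 < A.τ) (h : CloseBatches A S S') (q : Config V)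
    (g : V → ℝ≥0∞) :
    ∑ a, privWeight A S q a * g a ≤
      ENNReal.ofReal (Real.exp ((α - 1) * (1 / 2 * (A.c / (A.s * A.τ)) ^ 2))) *
        (∑ a, privWeight A S' q a * g a ^ p) ^ (1 / p) := by
  let _ : MeasurableSpace V := ⊤
  have : Nonempty V := ⟨A.eos⟩
  let μ : Finset (List V) → Measure V := fun S => ∑ a, privWeight A S q a • Measure.dirac a
  have hμ : ∀ S (g : V → ℝ≥0∞), ∫⁻ a, g a ∂μ S = ∑ a, privWeight A S q a * g a := by
    intro S g
    simp only [μ]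
    rw [lintegral_finsetSum_measure]
    simp_rw [lintegral_smul_measure, lintegral_dirac, smul_eq_mul]
  have hprob : ∀ S, IsProbabilityMeasure (μ S) := fun S =>
    ⟨by rw [← lintegral_one, hμ]; simp [sum_privWeight]⟩
  obtain ⟨κ, hκ⟩ := exists_softmax_bounds (Δ := A.c / (A.s * A.τ))
    (z := fun i => aggregate A.c A.s (batchLogits A S q.x) i / A.τ)
    (z' := fun i => aggregate A.c A.s (batchLogits A S' q.x) i / A.τ) (fun i => by
      rw [← sub_div, abs_div, abs_of_pos hτ, ← div_div]
      gcongr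
      exact (h q.x).1 i)
  have h1 : ENNReal.ofReal (Real.exp (κ - A.c / (A.s * A.τ))) • μ S' ≤ μ S := by
    refine Measure.le_iff.2 fun O hO => ?_
    rw [Measure.smul_apply, smul_eq_mul, ← lintegral_indicator_one hO,
      ← lintegral_indicator_one hO, hμ, hμ, Finset.mul_sum]
    refine Finset.sum_le_sum fun a _ => ?_
    rw [← mul_assoc, privWeight, privWeight, ← ENNReal.ofReal_mul (Real.exp_pos _).le]
    gcongr
    exact (hκ a).1
  have h2 : μ S ≤ ENNReal.ofReal (Real.exp (κ + A.c / (A.s * A.τ))) • μ S' := by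
    refine Measure.le_iff.2 fun O hO => ?_
    rw [Measure.smul_apply, smul_eq_mul, ← lintegral_indicator_one hO,
      ← lintegral_indicator_one hO, hμ, hμ, Finset.mul_sum]
    refine Finset.sum_le_sum fun a _ => ?_
    rw [← mul_assoc, privWeight, privWeight, ← ENNReal.ofReal_mul (Real.exp_pos _).le]
    gcongr
    exact (hκ a).2
  have hB := holderBound_of_smul_le hα h1 h2 g Measurable.of_discrete
  rw [hμ, hμ] at hB
  refine hB.trans_eq ?_
  -- The interval from `κ - Δ` to `κ + Δ` has length `2 Δ`, and `(2 Δ) ^ 2 / 8 = Δ ^ 2 / 2`.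
  congr 4
  ring

variable [DecidableEq V]

theorem holderBound_roundLaw {α p : ℝ} (hα : α.HolderConjugate p) {A : Params V}
    {S S' : Finset (List V)} (hs : 0 < A.s) (hσ : 0 < A.σ) (h : CloseBatches A S S')
    (q : Config V) :
    HolderBound p (ENNReal.ofReal (Real.exp ((α - 1) * (2 / (A.s * A.σ) ^ 2))))
      (roundLaw A S q) (roundLaw A S' q) := by
  have := isProbabilityMeasure_roundLaw A S hσ q
  have := isProbabilityMeasure_roundLaw A S' hσ q
  have h1 : ENNReal.ofReal (Real.exp (-(2 / (A.s * A.σ)))) • roundLaw A S' q ≤ roundLaw A S q := by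
    refine Measure.le_iff.2 fun O _ => ?_
    have := roundLaw_le_smul hs hσ h.symm q O
    calc _ ≤ ENNReal.ofReal (Real.exp (-(2 / (A.s * A.σ)))) *
          (ENNReal.ofReal (Real.exp (2 / (A.s * A.σ))) * roundLaw A S q O) :=
          mul_le_mul_right this _
      _ = _ := by
          rw [← mul_assoc, ← ENNReal.ofReal_mul (Real.exp_pos _).le, ← Real.exp_add,
            neg_add_cancel, Real.exp_zero, ENNReal.ofReal_one, one_mul]
  have hB := holderBound_of_smul_le hα h1 (roundLaw_le_smul hs hσ h q)
  have e : (2 / (A.s * A.σ) - -(2 / (A.s * A.σ))) ^ 2 / 8 = 2 / (A.s * A.σ) ^ 2 := by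
    field_simp
    norm_num
  rwa [e] at hB

/-- Adaptive composition, with `j` bounding the number of private tokens still to come. One round
applies the induction hypothesis, the bound for the token and the bound for the stopping
configuration; at each stage the outer `p`-th power cancels the `p`-th root left by the previous
one. Allowing an arbitrary payoff `F` makes this a Hölder bound for the output law. -/
theorem freshValue_le {α p : ℝ} (hα : α.HolderConjugate p) {A : Params V}
    {S S' : Finset (List V)} (hs : 0 < A.s) (hτ : 0 < A.τ) (hσ : 0 < A.σ)
    (h : CloseBatches A S S') (F : Finset (List V) → ℝ≥0∞) (j : ℕ) (q : Config V)
    (hj : A.r ≤ q.t + j) :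
    freshValue A S F q ≤
      ENNReal.ofReal (Real.exp ((α - 1) *
        (j * (1 / 2 * (A.c / (A.s * A.τ)) ^ 2 + 2 / (A.s * A.σ) ^ 2)))) *
      freshValue A S' (fun X => F X ^ p) q ^ (1 / p) := by
  have hα1 : 0 < α - 1 := sub_pos.2 hα.lt
  have hp0 : p ≠ 0 := hα.symm.ne_zero
  set ρ₁ := 1 / 2 * (A.c / (A.s * A.τ)) ^ 2 with hρ₁
  set ρ₂ := 2 / (A.s * A.σ) ^ 2 with hρ₂
  have hρ : 0 ≤ ρ₁ + ρ₂ := by positivity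
  -- After halting both payoffs agree, `F = (F ^ p) ^ (1 / p)`. Since `j` is only an upper bound,
  -- the constant left over must be at least `1`.
  have hhalt : ∀ (j : ℕ) (q : Config V), A.r ≤ q.t → freshValue A S F q ≤
      ENNReal.ofReal (Real.exp ((α - 1) * (j * (ρ₁ + ρ₂)))) *
        freshValue A S' (fun X => F X ^ p) q ^ (1 / p) := by
    intro j q hq
    rw [freshValue_of_le A S F hσ hq, freshValue_of_le A S' _ hσ hq, ← ENNReal.rpow_mul,
      mul_one_div_cancel hp0, ENNReal.rpow_one]
    refine le_mul_of_one_le_left zero_le ?_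
    rw [ENNReal.one_le_ofReal, Real.one_le_exp_iff]
    positivity
  induction j generalizing q with
  | zero => exact hhalt 0 q hj
  | succ j ih =>
    rcases le_or_gt A.r q.t with hq | hq
    · exact hhalt _ q hq
    set C := ENNReal.ofReal (Real.exp ((α - 1) * (j * (ρ₁ + ρ₂)))) with hC
    set C₁ := ENNReal.ofReal (Real.exp ((α - 1) * ρ₁)) with hC₁
    set C₂ := ENNReal.ofReal (Real.exp ((α - 1) * ρ₂)) with hC₂
    have hG : ∀ y : Config V, y.t = q.t → privateValue A S F y ≤
        C * C₁ * privateValue A S' (fun X => F X ^ p) y ^ (1 / p) := by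
      intro y hy
      rw [privateValue]
      calc _ ≤ ∑ a, privWeight A S y a *
            (C * freshValue A S' (fun X => F X ^ p) (y.append A a (y.t + 1)) ^ (1 / p)) := by
            gcongr with a _
            exact ih _ (by rw [Config.append_t]; omega)
        _ = C * ∑ a, privWeight A S y a *
            freshValue A S' (fun X => F X ^ p) (y.append A a (y.t + 1)) ^ (1 / p) := by
            simp_rw [mul_left_comm _ C, ← Finset.mul_sum]
        _ ≤ C * (C₁ * (∑ a, privWeight A S' y a *
            (freshValue A S' (fun X => F X ^ p) (y.append A a (y.t + 1)) ^ (1 / p)) ^ p)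
              ^ (1 / p)) := by
            gcongr
            exact sum_privWeight_mul_le hα hτ h y _
        _ = _ := by
            simp_rw [← ENNReal.rpow_mul, one_div_mul_cancel hp0, ENNReal.rpow_one, mul_assoc]
            rfl
    rw [freshValue_of_lt A S F hq, freshValue_of_lt A S' _ hq]
    calc _ ≤ ∫⁻ y, C * C₁ * privateValue A S' (fun X => F X ^ p) y ^ (1 / p)
            ∂roundLaw A S q := by
          refine lintegral_mono_ae ?_
          filter_upwards [ae_roundLaw_t_eq A S q] with y hy using hG y hy
      _ = C * C₁ * ∫⁻ y, privateValue A S' (fun X => F X ^ p) y ^ (1 / p) ∂roundLaw A S q :=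
          lintegral_const_mul _ Measurable.of_discrete
      _ ≤ C * C₁ * (C₂ * (∫⁻ y, (privateValue A S' (fun X => F X ^ p) y ^ (1 / p)) ^ p
            ∂roundLaw A S' q) ^ (1 / p)) := by
          gcongr
          exact holderBound_roundLaw hα hs hσ h q _ Measurable.of_discrete
      _ = _ := by
          simp_rw [← ENNReal.rpow_mul, one_div_mul_cancel hp0, ENNReal.rpow_one]
          rw [← mul_assoc, hC, hC₁, hC₂, ← ENNReal.ofReal_mul (Real.exp_pos _).le,
            ← ENNReal.ofReal_mul (by positivity), ← Real.exp_add, ← Real.exp_add]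
          congr 3
          push_cast
          ring

theorem freshValue_one (A : Params V) (S : Finset (List V)) (hσ : 0 < A.σ) (j : ℕ)
    (q : Config V) (hj : A.r ≤ q.t + j) : freshValue A S 1 q = 1 := by
  induction j generalizing q with
  | zero => exact freshValue_of_le A S 1 hσ hj
  | succ j ih =>
    rcases le_or_gt A.r q.t with hq | hq
    · exact freshValue_of_le A S 1 hσ hq
    have := isProbabilityMeasure_roundLaw A S hσ q
    rw [freshValue_of_lt A S 1 hq, lintegral_congr_ae (g := fun _ => 1), lintegral_one,
      measure_univ]
    filter_upwards [ae_roundLaw_t_eq A S q] with y hy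
    rw [privateValue, ← sum_privWeight A S y]
    refine Finset.sum_congr rfl fun a _ => ?_
    rw [ih _ (by rw [Config.append_t]; omega), mul_one]

theorem haltProb_eq (A : Params V) (S : Finset (List V)) (n : ℕ) (X : Finset (List V)) :
    haltProb A S n X =
      ∫⁻ η, valueAt A S (Pi.single X 1) n (A.θ + η, ⟨0, [], ∅⟩) ∂laplace A.σ := by
  have hm : MeasurableSet {st : State V | A.r ≤ st.2.t ∧ st.2.X = X} :=
    (MeasurableSet.of_discrete (s := {q : Config V | A.r ≤ q.t ∧ q.X = X})).preimage measurable_snd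
  have e : haltPayoff A (Pi.single X 1)
      = {st : State V | A.r ≤ st.2.t ∧ st.2.X = X}.indicator 1 := by
    ext st
    by_cases h1 : A.r ≤ st.2.t <;> by_cases h2 : st.2.X = X <;>
      simp [haltPayoff, Set.indicator, h1, h2]
  rw [haltProb, Measure.bind_apply hm (Kernel.measurable _).aemeasurable, initLaw,
    lintegral_map ((steps A S n).measurable_coe hm) (by fun_prop)]
  simp_rw [valueAt, e, lintegral_indicator_one hm]

/-- Links the output law, defined by point masses, to payoffs: `F` is a sum of multiples of
indicators of single outputs, and monotonicity in `n` lets the limit pass through the sum. -/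
theorem lintegral_batchLaw (A : Params V) (S : Finset (List V)) (F : Finset (List V) → ℝ≥0∞) :
    ∫⁻ X, F X ∂batchLaw A S = freshValue A S F ⟨0, [], ∅⟩ := by
  have hpay : ∀ st, haltPayoff A F st = ∑' X, F X * haltPayoff A (Pi.single X 1) st := by
    intro st
    rw [tsum_eq_single st.2.X fun X hX => ?_]
    · simp [haltPayoff]
    · simp [haltPayoff, Pi.single_eq_of_ne hX.symm]
  have hval : ∀ n st, valueAt A S F n st = ∑' X, F X * valueAt A S (Pi.single X 1) n st := by
    intro n st
    simp_rw [valueAt]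
    rw [lintegral_congr hpay,
      lintegral_tsum fun X => ((measurable_haltPayoff A _).const_mul _).aemeasurable]
    exact tsum_congr fun X => lintegral_const_mul _ (measurable_haltPayoff A _)
  have hm : ∀ X n, Measurable fun η => valueAt A S (Pi.single X 1) n (A.θ + η, ⟨0, [], ∅⟩) :=
    fun X n => (measurable_valueAt A S _ n).comp (by fun_prop)
  have hn : ∀ n, ∫⁻ η, valueAt A S F n (A.θ + η, ⟨0, [], ∅⟩) ∂laplace A.σ
      = ∑' X, F X * haltProb A S n X := by
    intro n
    rw [lintegral_congr fun η => hval n _,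
      lintegral_tsum fun X => ((hm X n).const_mul _).aemeasurable]
    refine tsum_congr fun X => ?_
    rw [lintegral_const_mul _ (hm X n), haltProb_eq]
  have hmono : ∀ X, Monotone fun n => haltProb A S n X := by
    intro X m n h
    dsimp only
    rw [haltProb_eq, haltProb_eq]
    exact lintegral_mono fun η => valueAt_mono A S _ _ h
  rw [freshValue_eq_iSup]
  simp_rw [hn]
  rw [batchLaw, lintegral_sum_measure]
  simp_rw [lintegral_smul_measure, lintegral_dirac, smul_eq_mul, ENNReal.tsum_eq_iSup_sum]
  rw [iSup_comm]
  refine iSup_congr fun T => ?_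
  have hmul : ∀ X, Monotone fun n => F X * haltProb A S n X :=
    fun X m n h => mul_le_mul_right (hmono X h) _
  rw [← ENNReal.finsetSum_iSup_of_monotone hmul]
  simp_rw [← ENNReal.mul_iSup, mul_comm]

/-- `batchLaw` counts halted runs only, so total mass `1` is almost sure termination. -/
theorem isProbabilityMeasure_batchLaw (A : Params V) (S : Finset (List V)) (hσ : 0 < A.σ) :
    IsProbabilityMeasure (batchLaw A S) := by
  constructor
  rw [← lintegral_one]
  exact (lintegral_batchLaw A S 1).trans (freshValue_one A S hσ A.r _ (by simp))

theorem holderBound_batchLaw {α p : ℝ} (hα : α.HolderConjugate p) {A : Params V}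
    {S S' : Finset (List V)} (hs : 0 < A.s) (hτ : 0 < A.τ) (hσ : 0 < A.σ)
    (h : CloseBatches A S S') :
    HolderBound p (ENNReal.ofReal (Real.exp ((α - 1) *
      (A.r * (1 / 2 * (A.c / (A.s * A.τ)) ^ 2 + 2 / (A.s * A.σ) ^ 2)))))
      (batchLaw A S) (batchLaw A S') := by
  intro F _
  rw [lintegral_batchLaw, lintegral_batchLaw]
  exact freshValue_le hα hs hτ hσ h F A.r _ (by simp)

theorem isProbabilityMeasure_algorithm (A : Params V) (hσ : 0 < A.σ) {k : ℕ}
    (f : List V → Fin k) (D : Finset (List V)) : IsProbabilityMeasure (algorithm A f D) := by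
  have := fun i => isProbabilityMeasure_batchLaw A (D.filter fun p => f p = i) hσ
  exact Measure.isProbabilityMeasure_map Measurable.of_discrete.aemeasurable

theorem holderBound_algorithm {α p : ℝ} (hα : α.HolderConjugate p) {A : Params V}
    (hs : 0 < A.s) (hc : 0 ≤ A.c) (hτ : 0 < A.τ) (hσ : 0 < A.σ) {k : ℕ} (f : List V → Fin k)
    {D D' : Finset (List V)} (h : Neighbors D D') :
    HolderBound p (ENNReal.ofReal (Real.exp ((α - 1) *
      (A.r * (1 / 2 * (A.c / (A.s * A.τ)) ^ 2 + 2 / (A.s * A.σ) ^ 2)))))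
      (algorithm A f D) (algorithm A f D') := by
  have := fun i => isProbabilityMeasure_batchLaw A (D.filter fun p => f p = i) hσ
  have := fun i => isProbabilityMeasure_batchLaw A (D'.filter fun p => f p = i) hσ
  obtain ⟨x, hx⟩ := h
  have key : CloseBatches A (D.filter fun p => f p = f x) (D'.filter fun p => f p = f x) ∧
      ∀ i ≠ f x, (D.filter fun p => f p = i) = D'.filter fun p => f p = i := by
    have hadd : ∀ E : Finset (List V),
        CloseBatches A ((E ∪ {x}).filter fun p => f p = f x) (E.filter fun p => f p = f x) ∧
        ∀ i ≠ f x, ((E ∪ {x}).filter fun p => f p = i) = E.filter fun p => f p = i := by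
      intro E
      rw [Finset.union_comm, ← Finset.insert_eq]
      refine ⟨?_, fun i hi => ?_⟩
      · rw [Finset.filter_insert, if_pos rfl]
        exact closeBatches_insert A hs hc _ x
      · rw [Finset.filter_insert, if_neg hi.symm]
    rcases hx with rfl | rfl
    · exact hadd D'
    · exact ⟨(hadd D).1.symm, fun i hi => ((hadd D).2 i hi).symm⟩
  refine (HolderBound.pi_of_eq_of_ne hα.symm.lt (f x) ?_ fun i hi => ?_).map
    Measurable.of_discrete
  · exact holderBound_batchLaw hα hs hτ hσ key.1
  · rw [key.2 i hi]

end Batch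

/-! ### From zCDP to approximate differential privacy. -/

section Conversion

theorem exists_conversion_le {ρ δ : ℝ} (hρ : 0 ≤ ρ) (hδ : 0 < δ) (hδ1 : δ < 1) :
    ∃ α : ℝ, 1 < α ∧
      Real.exp ((α - 1) * (α * ρ - (ρ + √(4 * ρ * Real.log (1 / δ))))) / (α - 1) *
        (1 - 1 / α) ^ α ≤ δ := by
  -- The left side equals `(1 - 1 / α) ^ (α - 1) / α`.
  have hfac : ∀ α : ℝ, 1 < α → 1 / (α - 1) * (1 - 1 / α) ^ α ≤ 1 / α := by
    intro α hα
    have hα0 : 0 < α := by linarith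
    have hα1 : 0 < α - 1 := by linarith
    have hu : 0 < 1 - 1 / α := by rw [sub_pos, div_lt_one hα0]; exact hα
    have hu1 : (1 - 1 / α) ^ (α - 1) ≤ 1 :=
      Real.rpow_le_one hu.le (by have := one_div_pos.2 hα0; linarith) hα1.le
    have e : (1 - 1 / α) ^ α = (1 - 1 / α) ^ (α - 1) * (1 - 1 / α) := by
      rw [← Real.rpow_add_one hu.ne']; ring_nf
    calc 1 / (α - 1) * (1 - 1 / α) ^ α = (1 - 1 / α) ^ (α - 1) * (1 / α) := by
          rw [e]; field_simp
      _ ≤ 1 * (1 / α) := by gcongr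
      _ = 1 / α := one_mul _
  rcases hρ.eq_or_lt with rfl | hρ
  -- For `ρ = 0` the exponential is `1`, and the bound `1 / α` alone must reach `δ`.
  · refine ⟨1 / δ, (one_lt_div hδ).2 hδ1, ?_⟩
    have := hfac (1 / δ) ((one_lt_div hδ).2 hδ1)
    simpa using this
  · set L := Real.log (1 / δ) with hL
    have hL0 : 0 < L := Real.log_pos ((one_lt_div hδ).2 hδ1)
    have hexp : Real.exp (-L) = δ := by
      rw [hL, one_div, Real.log_inv, neg_neg, Real.exp_log hδ]
    set w := √(L / ρ) with hw
    have hw0 : 0 < w := Real.sqrt_pos.2 (by positivity)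
    have hw2 : w ^ 2 * ρ = L := by
      rw [hw, Real.sq_sqrt (by positivity)]; field_simp
    have hsq : √(4 * ρ * L) = 2 * ρ * w := by
      rw [← hw2, show 4 * ρ * (w ^ 2 * ρ) = (2 * ρ * w) ^ 2 by ring,
        Real.sqrt_sq (by positivity)]
    -- `α = 1 + √(L / ρ)` minimizes the quadratic exponent; the minimum is `-L`, whose exponential
    -- is `δ`.
    refine ⟨1 + w, by linarith, ?_⟩
    have e : (1 + w - 1) * ((1 + w) * ρ - (ρ + √(4 * ρ * L))) = -L := by
      rw [hsq, ← hw2]; ring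
    rw [e, hexp, div_mul_eq_mul_div, mul_div_assoc]
    have h1 := hfac (1 + w) (by linarith)
    have h2 : 1 / (1 + w) ≤ 1 := by
      rw [div_le_one (by positivity)]; linarith
    rw [one_div_mul_eq_div] at h1
    nlinarith

theorem le_ofReal_mul_add {Ω : Type*} [MeasurableSpace Ω] {μ ν : Measure Ω} [IsFiniteMeasure μ]
    [IsFiniteMeasure ν] {O : Set Ω} {ε δ : ℝ}
    (h : μ.real O ≤ Real.exp ε * ν.real O + δ) :
    μ O ≤ ENNReal.ofReal (Real.exp ε) * ν O + ENNReal.ofReal δ := by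
  rw [← ofReal_measureReal (μ := μ), ← ofReal_measureReal (μ := ν),
    ← ENNReal.ofReal_mul (Real.exp_pos _).le]
  exact (ENNReal.ofReal_le_ofReal h).trans ENNReal.ofReal_add_le

end Conversion

end PrivatePrediction

theorem theorem1 {V : Type*} [Fintype V] [DecidableEq V] (A : Params V)
    (hs : 0 < A.s) (hc : 0 ≤ A.c) (hτ : 0 < A.τ) (hτpub : 0 < A.τpub) (hσ : 0 < A.σ)
    {k : ℕ} (f : List V → Fin k) (ρ : ℝ)
    (hρ : ρ = A.r * (1 / 2 * (A.c / (A.s * A.τ)) ^ 2 + 2 / (A.s * A.σ) ^ 2)) :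
    (∀ D : Finset (List V), IsProbabilityMeasure (algorithm A f D)) ∧
    IsZCDP (algorithm A f) ρ ∧
    (∀ ε : ℝ, 0 ≤ ε → IsDP (algorithm A f) ε
      (⨅ α : Set.Ioi (1 : ℝ),
        Real.exp ((α - 1) * (α * ρ - ε)) / (α - 1) * (1 - 1 / (α : ℝ)) ^ (α : ℝ))) ∧
    (∀ δ : ℝ, 0 < δ → δ ≤ 1 →
      IsDP (algorithm A f) (ρ + √(4 * ρ * Real.log (1 / δ))) δ) := by
  have hprob := isProbabilityMeasure_algorithm A hσ f
  have hρ0 : 0 ≤ ρ := by rw [hρ]; positivity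
  have key : ∀ {α : ℝ}, 1 < α → ∀ {D D' : Finset (List V)}, Neighbors D D' →
      HolderBound (Real.conjExponent α) (ENNReal.ofReal (Real.exp ((α - 1) * ρ)))
        (algorithm A f D) (algorithm A f D') := fun hα _ _ h => by
    rw [hρ]
    exact holderBound_algorithm (Real.HolderConjugate.conjExponent hα) hs hc hτ hσ f h
  have hdp : ∀ {α : ℝ}, 1 < α → ∀ {D D' : Finset (List V)}, Neighbors D D' → ∀ (ε : ℝ)
      (O : Set (Finset (List V))), (algorithm A f D).real O ≤
        Real.exp ε * (algorithm A f D').real O +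
          Real.exp ((α - 1) * (α * ρ - ε)) / (α - 1) * (1 - 1 / α) ^ α := fun hα _ _ h ε O =>
    (key hα h).apply_le_exp_mul_add (Real.HolderConjugate.conjExponent hα)
      (MeasurableSet.of_discrete (s := O))
  refine ⟨hprob, fun α hα D D' h => ?_, fun ε _ D D' h O => ?_, fun δ hδ hδ1 D D' h O => ?_⟩
  · exact (key hα h).renyiDiv_le (Real.HolderConjugate.conjExponent hα)
  · refine le_ofReal_mul_add (sub_le_iff_le_add'.1 ?_)
    have : Nonempty (Set.Ioi (1 : ℝ)) := ⟨⟨2, Set.mem_Ioi.2 one_lt_two⟩⟩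
    exact le_ciInf fun α => sub_le_iff_le_add'.2 (hdp α.2 h ε O)
  -- At `δ = 1` the minimizing order would degenerate to `α = 1`, but the claim is then trivial for
  -- probability measures.
  · rcases hδ1.eq_or_lt with rfl | hδ1
    · rw [ENNReal.ofReal_one]
      exact prob_le_one.trans le_add_self
    · obtain ⟨α, hα, hle⟩ := exists_conversion_le hρ0 hδ hδ1
      refine le_ofReal_mul_add ((hdp hα h (ρ + √(4 * ρ * Real.log (1 / δ))) O).trans ?_)
      gcongr
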